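/- Let $F\in\mathbb R[x]$ be an even polynomial, let $L$ be the Liénard vector field on $\mathbb R^2$ given by $\dot x=y-F(x)$, $\dot y=-x$, and put $p=(0,F(0))$ (the origin when $F(0)=0$). A closed orbit is the image of a nonconstant periodic solution. An analytic first integral of $L$ on an open set $U$ is a real-analytic function on $U$ whose derivative along $L$ vanishes and which is not constant on any nonempty open subset of $U$. Then: (a) $p$ is a center of $L$: $L(p)=0$ and $p$ has a neighbourhood $U$ such that $U\setminus\{p\}$ is a union of closed orbits. (b) $L$ has a global analytic first integral on $\mathbb R^2$; it can be chosen of the form $H(x^2,y)$ with $H$ real-analytic at every point of the closed half plane $\{(u,y):u\ge 0\}$. (c) Near the center such a first integral is given by the intersection of the orbits with the parabola $y=F(0)-x^2$ (that is, $y=-x^2$ when $F(0)=0$): $p$ has an open neighbourhood $U$ such that every point $z\in U\setminus\{p\}$ lies on a closed orbit $S_z\subset U$ which meets the parabola in exactly two points $(\pm a_z,F(0)-a_z^2)$, $a_z>0$, and the function $z\mapsto a_z^2$, $p\mapsto 0$, is an analytic first integral of $L$ on $U$, of the form $H(x^2,y)$ with $H$ real-analytic at $(x^2,y)$ for every $(x,y)\in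 U$. (d) Let $\mathcal F$ be either $C^\infty(\mathbb R^2)$ or the space $C^\omega(\mathbb R^2)$ of real-analytic functions, and consider the linear operator $\mathcal F\to\mathcal F$, $f\mapsto L\cdot f$ (derivative of $f$ along $L$). Both its kernel and its cokernel are infinite-dimensional real vector spaces. Moreover, let $\gamma_1,\dots,\gamma_m$ be distinct closed orbits of $L$, and say that $f$ separates them if the sets $f(\gamma_1),\dots,f(\gamma_m)$ are pairwise disjoint. Then some polynomial function separates them, and for every $f\in\mathcal F$ that separates them, the classes of $1,f,f^2,\dots,f^{m-1}$ in the cokernel are linearly independent. -/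

import Mathlib

open scoped ContDiff

/-- The Liénard vector field `x' = y - F x`, `y' = -x` of a polynomial `F`. -/
noncomputable def lienardField (F : Polynomial ℝ) (z : ℝ × ℝ) : ℝ × ℝ :=
  (z.2 - F.eval z.1, -z.1)

/-- `S` is a closed orbit: the image of a nonconstant periodic solution. -/
def IsClosedOrbit (F : Polynomial ℝ) (S : Set (ℝ × ℝ)) : Prop :=
  ∃ c : ℝ → ℝ × ℝ, (∀ t, HasDerivAt c (lienardField F (c t)) t) ∧
    (∃ T : ℝ, 0 < T ∧ Function.Periodic c T) ∧ (∃ t, c t ≠ c 0) ∧ S = Set.range c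

/-- `p` is a center: an equilibrium with a neighbourhood `U` such that `U \ {p}` is a union of
closed orbits. -/
def IsLienardCenter (F : Polynomial ℝ) (p : ℝ × ℝ) : Prop :=
  lienardField F p = 0 ∧
    ∃ U ∈ nhds p, ∀ z ∈ U, z ≠ p → ∃ S, IsClosedOrbit F S ∧ z ∈ S ∧ S ⊆ U

/-- `I` is a real-analytic first integral on `U`: analytic, annihilated by the
vector field, and not constant on any nonempty open subset of `U`. -/
def IsAnalyticFirstIntegralOn (F : Polynomial ℝ) (U : Set (ℝ × ℝ)) (I : ℝ × ℝ → ℝ) : Prop :=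
  AnalyticOnNhd ℝ I U ∧ (∀ z ∈ U, fderiv ℝ I z (lienardField F z) = 0) ∧
    ∀ V ⊆ U, IsOpen V → V.Nonempty → ∃ z ∈ V, ∃ w ∈ V, I z ≠ I w

/-- The algebra of real functions of class `C^n` on the plane. -/
def planeFunctions (n : WithTop ℕ∞) : Subalgebra ℝ (ℝ × ℝ → ℝ) where
  carrier := {f | ContDiff ℝ n f}
  mul_mem' hf hg := ContDiff.mul hf hg
  add_mem' hf hg := ContDiff.add hf hg
  algebraMap_mem' _ := contDiff_const

theorem contDiff_lienardField (F : Polynomial ℝ) (n : WithTop ℕ∞) :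
    ContDiff ℝ n (lienardField F) := by
  have h : ContDiff ℝ n (fun x : ℝ => F.eval x) := by
    simpa [Polynomial.aeval_def, Polynomial.eval₂_eq_eval_map] using F.contDiff_aeval (𝕜 := ℝ) n
  exact (contDiff_snd.sub (h.comp contDiff_fst)).prodMk contDiff_fst.neg

theorem add_one_le_of_smooth_or_analytic {n : WithTop ℕ∞} (hn : n = ∞ ∨ n = ω) :
    n + 1 ≤ n := by
  rcases hn with rfl | rfl
  · exact le_rfl
  · exact le_top

/-- The operator `f ↦ L·f` (derivative of `f` along the Liénard field) on the space of smooth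
(`n = ∞`) or real-analytic (`n = ω`) functions on the plane. -/
noncomputable def lienardOperator (F : Polynomial ℝ) (n : WithTop ℕ∞) (hn : n = ∞ ∨ n = ω) :
    planeFunctions n →ₗ[ℝ] planeFunctions n where
  toFun f := ⟨fun z => fderiv ℝ f.1 z (lienardField F z),
    ContDiff.clm_apply (ContDiff.fderiv_right f.2 (add_one_le_of_smooth_or_analytic hn))
      (contDiff_lienardField F n)⟩
  map_add' f g := by
    have h1 : (1 : WithTop ℕ∞) ≤ n := by
      rcases hn with rfl | rfl
      · exact_mod_cast le_top
      · exact le_top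
    have hn0 : n ≠ 0 := (lt_of_lt_of_le zero_lt_one h1).ne'
    have hf : Differentiable ℝ f.1 := ContDiff.differentiable f.2 hn0
    have hg : Differentiable ℝ g.1 := ContDiff.differentiable g.2 hn0
    ext z
    change fderiv ℝ (f.1 + g.1) z _ = fderiv ℝ f.1 z _ + fderiv ℝ g.1 z _
    rw [fderiv_add (hf z) (hg z)]
    rfl
  map_smul' a f := by
    have h1 : (1 : WithTop ℕ∞) ≤ n := by
      rcases hn with rfl | rfl
      · exact_mod_cast le_top
      · exact le_top
    have hn0 : n ≠ 0 := (lt_of_lt_of_le zero_lt_one h1).ne'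
    have hf : Differentiable ℝ f.1 := ContDiff.differentiable f.2 hn0
    ext z
    change fderiv ℝ (a • f.1) z _ = a • fderiv ℝ f.1 z _
    rw [fderiv_const_smul (hf z)]
    rfl

/-- The cokernel of `f ↦ L·f`. -/
abbrev lienardCokernel (F : Polynomial ℝ) (n : WithTop ℕ∞) (hn : n = ∞ ∨ n = ω) : Type :=
  planeFunctions n ⧸ LinearMap.range (lienardOperator F n hn)

/-- `f` separates the sets `γ i`: no value of `f` is taken on two of them. -/
def SeparatesSets {ι : Type*} (f : ℝ × ℝ → ℝ) (γ : ι → Set (ℝ × ℝ)) : Prop :=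
  ∀ i j, i ≠ j → Disjoint (f '' γ i) (f '' γ j)

/-! ### Integral curves of C¹ fields -/

open scoped Topology Manifold

/-! Since `F` is even, `F(x) = f(x²)`. With `u = x²` the field `L` becomes `-x` times the
nonsingular direction field `u' = 2(f(u) - y)`, `y' = 1` on the half plane `u ≥ 0`. A first integral
`H(u, y)` of that foliation therefore pulls back to a first integral `J = H(x², y)` of `L`.

The function `H` comes from a global transversal. One of `f`, `-f` is bounded above on `u ≥ 0`, and
`y ↦ -y` exchanges the two cases. If `f ≤ M`, then `u + (y - M)²` does not increase along a leaf in
the half plane, so the leaf cannot run off to infinity before crossing. It follows that every leaf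
through the half plane meets the ray `w ↦ (k w, f(0) + w)` at some `w ≥ 0`, and transversality makes
the crossing unique. The crossing parameter, multiplied by `k`, is `H`. It is analytic because the
leaf flow is, which follows from the implicit function theorem in a space of paths
(`contDiffAt_flow_of_superposition`, `exists_leafIntegral`).

Near `p` the normalization `H_u = 1` gives `J ≥ (x² + (y - F(0))²)/2`, so small sublevel sets of `J`
trap orbits. The orbits rotate, hence hit `x = 0` repeatedly, and the reversing symmetry `(x, t) ↦
(-x, -t)` closes them up. On the parabola `y = F(0) - x²`, `J` is a locally invertible analytic
function `m` of `x²`, so `m⁻¹ ∘ J` is the squared abscissa of the intersection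
(`exists_local_first_integral`).

Powers of `J` fill the kernel. For the cokernel, if `∑ gₖ fᵏ = L·h`, then by Rolle's theorem the
left side vanishes somewhere on every closed orbit. Separation makes the resulting values of `f`
distinct, and a Vandermonde determinant forces `g = 0`. Stone–Weierstrass supplies a separating
polynomial. -/

theorem isMIntegralCurveOn_iff_hasDerivWithinAt {E : Type*} [NormedAddCommGroup E]
    [NormedSpace ℝ E] {v : E → E} {c : ℝ → E} {s : Set ℝ} :
    IsMIntegralCurveOn (I := 𝓘(ℝ, E)) c v s ↔ ∀ t ∈ s, HasDerivWithinAt c (v (c t)) s t := by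
  refine forall₂_congr fun t _ => ?_
  have h : (ContinuousLinearMap.smulRight (1 : ℝ →L[ℝ] ℝ) (v (c t)) : ℝ →L[ℝ] E) =
      ContinuousLinearMap.toSpanSingleton ℝ (v (c t)) := by ext; simp
  rw [hasDerivWithinAt_iff_hasFDerivWithinAt, ← h]
  exact hasMFDerivWithinAt_iff_hasFDerivWithinAt

theorem isMIntegralCurve_iff_hasDerivAt {E : Type*} [NormedAddCommGroup E]
    [NormedSpace ℝ E] {v : E → E} {c : ℝ → E} :
    IsMIntegralCurve (I := 𝓘(ℝ, E)) c v ↔ ∀ t, HasDerivAt c (v (c t)) t := by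
  refine forall_congr' fun t => ?_
  have h : (ContinuousLinearMap.smulRight (1 : ℝ →L[ℝ] ℝ) (v (c t)) : ℝ →L[ℝ] E) =
      ContinuousLinearMap.toSpanSingleton ℝ (v (c t)) := by ext; simp
  rw [hasDerivAt_iff_hasFDerivAt, ← h]
  exact hasMFDerivAt_iff_hasFDerivAt

theorem integralCurve_unique {E : Type*} [NormedAddCommGroup E] [NormedSpace ℝ E]
    {v : E → E} (hv : ContDiff ℝ 1 v) {c d : ℝ → E}
    (hc : ∀ t, HasDerivAt c (v (c t)) t) (hd : ∀ t, HasDerivAt d (v (d t)) t) {t₀ : ℝ}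
    (h : c t₀ = d t₀) : c = d := by
  have hv' : ContMDiff 𝓘(ℝ, E) 𝓘(ℝ, E).tangent 1 (fun x => (⟨x, v x⟩ : TangentBundle 𝓘(ℝ, E) E)) :=
    contMDiff_vectorSpace_iff_contDiff.2 hv
  exact isMIntegralCurve_Ioo_eq_of_contMDiff_boundaryless hv'
    (isMIntegralCurve_iff_hasDerivAt.2 hc) (isMIntegralCurve_iff_hasDerivAt.2 hd) h

/-- With speed at most `M`, a curve stays in the ball of radius `M` for unit time, so
Picard–Lindelöf gives an existence time independent of the starting point; local solutions then
extend to all times. -/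
theorem exists_integralCurve_of_bounded {E : Type*} [NormedAddCommGroup E] [NormedSpace ℝ E]
    [FiniteDimensional ℝ E] {v : E → E} (hv : ContDiff ℝ 1 v) {M : ℝ} (hM : ∀ z, ‖v z‖ ≤ M)
    (z : E) : ∃ c : ℝ → E, c 0 = z ∧ ∀ t, HasDerivAt c (v (c t)) t := by
  have hv' : ContMDiff 𝓘(ℝ, E) 𝓘(ℝ, E).tangent 1 (fun x => (⟨x, v x⟩ : TangentBundle 𝓘(ℝ, E) E)) :=
    contMDiff_vectorSpace_iff_contDiff.2 hv
  obtain ⟨c, hc0, hc⟩ := exists_isMIntegralCurve_of_isMIntegralCurveOn hv' one_pos (fun x => by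
    have := FiniteDimensional.proper_real E
    have hM0 : 0 ≤ M := (norm_nonneg _).trans (hM x)
    obtain ⟨K, hK⟩ := hv.contDiffOn.exists_lipschitzOnWith one_ne_zero
      (convex_closedBall x M) (isCompact_closedBall x M)
    have hP : IsPicardLindelof (fun _ => v) (tmin := -1) (tmax := 1)
        ⟨(0 : ℝ), by norm_num, by norm_num⟩ x ⟨M, hM0⟩ 0 ⟨M, hM0⟩ K :=
      IsPicardLindelof.of_time_independent (fun y _ => hM y) hK (by simp)
    obtain ⟨α, h0, hα⟩ := hP.exists_eq_forall_mem_Icc_hasDerivWithinAt₀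
    refine ⟨α, h0, ?_⟩
    refine isMIntegralCurveOn_iff_hasDerivWithinAt.2 fun t ht => ?_
    exact (hα t (Set.Ioo_subset_Icc_self ht)).mono Set.Ioo_subset_Icc_self) z
  exact ⟨c, hc0, isMIntegralCurve_iff_hasDerivAt.1 hc⟩

/-! ### Analytic dependence of a flow on time and initial value -/

open scoped unitInterval

/-- Integration from `0`, as an operator on continuous functions on the unit interval. -/
noncomputable def unitIntervalIntegral (E : Type*) [NormedAddCommGroup E] [NormedSpace ℝ E] :
    C(I, E) →L[ℝ] C(I, E) :=
  LinearMap.mkContinuous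
    { toFun := fun a => ⟨fun t => ∫ s in (0 : ℝ)..t, a (Set.projIcc 0 1 zero_le_one s), by
        have h : Continuous fun s => a (Set.projIcc 0 1 zero_le_one s) :=
          a.continuous.comp continuous_projIcc
        exact (intervalIntegral.continuous_primitive
          (fun x y => h.intervalIntegrable x y) 0).comp continuous_subtype_val⟩
      map_add' := fun a b => by
        ext t
        have h (a : C(I, E)) : Continuous fun s => a (Set.projIcc 0 1 zero_le_one s) :=
          a.continuous.comp continuous_projIcc
        exact intervalIntegral.integral_add ((h a).intervalIntegrable _ _)
          ((h b).intervalIntegrable _ _)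
      map_smul' := fun r a => by
        ext t
        exact intervalIntegral.integral_smul r _ }
    1 (fun a => by
      rw [ContinuousMap.norm_le _ (by positivity)]
      intro t
      refine (intervalIntegral.norm_integral_le_of_norm_le_const
        (C := ‖a‖) fun s _ => a.norm_coe_le_norm _).trans ?_
      rw [one_mul, sub_zero, abs_of_nonneg t.2.1]
      exact mul_le_of_le_one_right (norm_nonneg _) t.2.2)

theorem unitIntervalIntegral_apply {E : Type*} [NormedAddCommGroup E] [NormedSpace ℝ E]
    (a : C(I, E)) (t : I) :
    unitIntervalIntegral E a t = ∫ s in (0 : ℝ)..t, a (Set.projIcc 0 1 zero_le_one s) := rfl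

/-- Analytic dependence on time and initial value, near time zero, of the flow of a bounded vector
field whose superposition operator on continuous paths is analytic at the constant paths. -/
theorem contDiffAt_flow_of_superposition {E : Type*} [NormedAddCommGroup E] [NormedSpace ℝ E]
    [CompleteSpace E] {v : E → E} {M : ℝ} (hM : ∀ z, ‖v z‖ ≤ M)
    {V : C(I, E) → C(I, E)} (hV : ∀ φ t, V φ t = v (φ t)) {z₀ : E}
    (hVd : ContDiffAt ℝ ω V (ContinuousMap.const I z₀))
    {c : E → ℝ → E} (hc0 : ∀ z, c z 0 = z) (hc : ∀ z t, HasDerivAt (c z) (v (c z t)) t) :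
    ContDiffAt ℝ ω (fun p : E × ℝ => c p.1 p.2) (z₀, 0) := by
  let ι : E →L[ℝ] C(I, E) := ContinuousLinearMap.const ℝ I
  -- The integral equation for the path rescaled to the unit interval, `φ(s) = z + τ ∫₀ˢ v(φ)`. Time
  -- has become the parameter `τ`, and at `τ = 0` the derivative in `φ` is the identity.
  let G : (E × ℝ) × C(I, E) → C(I, E) := fun q =>
    q.2 - ι q.1.1 - q.1.2 • unitIntervalIntegral E (V q.2)
  let u : (E × ℝ) × C(I, E) := ((z₀, 0), ι z₀)
  have hG : ContDiffAt ℝ ω G u := by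
    have h1 : ContDiffAt ℝ ω (fun q : (E × ℝ) × C(I, E) => V q.2) u :=
      ContDiffAt.comp u (g := V) (f := Prod.snd) hVd contDiffAt_snd
    have h2 : ContDiffAt ℝ ω
        (fun q : (E × ℝ) × C(I, E) => unitIntervalIntegral E (V q.2)) u :=
      (unitIntervalIntegral E).contDiff.contDiffAt.comp u h1
    have h3 : ContDiffAt ℝ ω (fun q : (E × ℝ) × C(I, E) => q.1.2) u := by fun_prop
    have h4 : ContDiffAt ℝ ω (fun q : (E × ℝ) × C(I, E) => q.2 - ι q.1.1) u := by fun_prop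
    exact h4.sub (h3.smul h2)
  have hGu : G u = 0 := by simp [G, u]
  have hinv : fderiv ℝ G u ∘L .inr ℝ (E × ℝ) C(I, E) = ContinuousLinearMap.id ℝ _ := by
    have h1 := (hG.differentiableAt (by simp)).hasFDerivAt.comp (ι z₀)
      (hasFDerivAt_prodMk_right (𝕜 := ℝ) (z₀, (0 : ℝ)) (ι z₀))
    have h2 : HasFDerivAt (G ∘ fun φ => ((z₀, (0 : ℝ)), φ)) (ContinuousLinearMap.id ℝ C(I, E))
        (ι z₀) := by
      have : (G ∘ fun φ => ((z₀, (0 : ℝ)), φ)) = fun φ => φ - ι z₀ := by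
        funext φ; simp [G]
      rw [this]
      exact (hasFDerivAt_id _).sub_const _
    exact h1.unique h2
  have hI : (fderiv ℝ G u ∘L .inr ℝ (E × ℝ) C(I, E)).IsInvertible := by
    rw [hinv]; exact ⟨ContinuousLinearEquiv.refl ℝ _, rfl⟩
  have hω : (ω : WithTop ℕ∞) ≠ 0 := by simp
  let S := hG.implicitFunction hω hI
  have hSd : ContDiffAt ℝ ω S (z₀, 0) := hG.contDiffAt_implicitFunction hω hI
  have hev := hG.eventually_apply_eq_iff_implicitFunction hω hI
  have hcc : ∀ z, Continuous (c z) := fun z =>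
    continuous_iff_continuousAt.2 fun t => (hc z t).continuousAt
  let γ : E × ℝ → C(I, E) := fun p => ⟨fun t => c p.1 (p.2 * t), by
    exact (hcc p.1).comp (by fun_prop)⟩
  have hγG : ∀ p, G (p, γ p) = 0 := by
    intro p
    ext t
    have hd : ∀ s ∈ Set.uIcc (0 : ℝ) t, HasDerivAt (fun s => c p.1 (p.2 * s))
        (p.2 • v (c p.1 (p.2 * s))) s := fun s _ => by
      have := (hc p.1 (p.2 * s)).scomp s ((hasDerivAt_id s).const_mul p.2)
      simpa using! this
    have hVγ : ∀ s ∈ Set.uIcc (0 : ℝ) t,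
        V (γ p) (Set.projIcc 0 1 zero_le_one s) = v (c p.1 (p.2 * s)) := fun s hs => by
      rw [Set.uIcc_of_le t.2.1] at hs
      have : s ∈ Set.Icc (0 : ℝ) 1 := ⟨hs.1, hs.2.trans t.2.2⟩
      rw [hV, Set.projIcc_of_mem _ this]
      rfl
    have hcont : ContinuousOn (fun s => p.2 • v (c p.1 (p.2 * s))) (Set.uIcc (0 : ℝ) t) := by
      refine ContinuousOn.congr (f := fun s => p.2 • V (γ p) (Set.projIcc 0 1 zero_le_one s)) ?_
        (fun s hs => by simp only [hVγ s hs])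
      exact (((V (γ p)).continuous.comp continuous_projIcc).const_smul p.2).continuousOn
    have hint := intervalIntegral.integral_eq_sub_of_hasDerivAt hd hcont.intervalIntegrable
    have e : unitIntervalIntegral E (V (γ p)) t = ∫ s in (0 : ℝ)..t, v (c p.1 (p.2 * s)) := by
      rw [unitIntervalIntegral_apply]
      exact intervalIntegral.integral_congr hVγ
    simp only [G, ContinuousMap.sub_apply, ContinuousMap.smul_apply, e, ContinuousMap.zero_apply]
    rw [← intervalIntegral.integral_smul, hint]
    simp [γ, ι, hc0]
  -- The implicit function captures only solutions near the base point; this bound brings the true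
  -- solution path into that neighbourhood.
  have hγlip : ∀ p : E × ℝ, ‖γ p - ι z₀‖ ≤ ‖p.1 - z₀‖ + M * |p.2| := by
    intro p
    have hM0 : 0 ≤ M := (norm_nonneg _).trans (hM z₀)
    rw [ContinuousMap.norm_le _ (by positivity)]
    intro t
    have h1 : ‖c p.1 (p.2 * t) - c p.1 0‖ ≤ M * ‖p.2 * (t : ℝ) - 0‖ :=
      Convex.norm_image_sub_le_of_norm_hasDerivWithin_le (s := Set.univ)
        (fun x _ => (hc p.1 x).hasDerivWithinAt) (fun x _ => hM _) convex_univ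
        (Set.mem_univ _) (Set.mem_univ _)
    rw [hc0, sub_zero, norm_mul, Real.norm_eq_abs, Real.norm_eq_abs, abs_of_nonneg t.2.1] at h1
    have h2 : M * (|p.2| * t) ≤ M * |p.2| :=
      mul_le_mul_of_nonneg_left (mul_le_of_le_one_right (abs_nonneg _) t.2.2) hM0
    calc ‖(γ p - ι z₀) t‖ = ‖(p.1 - z₀) + (c p.1 (p.2 * t) - p.1)‖ := by
          congr 1; simp [γ, ι]
      _ ≤ _ := (norm_add_le _ _).trans (by linarith)
  have hγ : Filter.Tendsto (fun p => (p, γ p)) (𝓝 (z₀, (0 : ℝ))) (𝓝 u) := by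
    refine Filter.tendsto_id.prodMk_nhds ?_
    rw [tendsto_iff_norm_sub_tendsto_zero]
    refine squeeze_zero (fun _ => norm_nonneg _) hγlip ?_
    have : Continuous fun p : E × ℝ => ‖p.1 - z₀‖ + M * |p.2| := by fun_prop
    simpa using this.tendsto (z₀, 0)
  have hfin : (fun p : E × ℝ => c p.1 p.2) =ᶠ[𝓝 (z₀, 0)]
      fun p => ContinuousMap.evalCLM ℝ (1 : I) (S p) := by
    filter_upwards [hγ.eventually hev] with p hp
    have e : S p = γ p := hp.1 ((hγG p).trans hGu.symm)
    simp [e, γ]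
  exact ((ContinuousLinearMap.contDiff _).contDiffAt.comp _ hSd).congr_of_eventuallyEq hfin

/-! ### The foliation of the `(u, y)` plane and its flow -/

/-- The direction field `u' = 2 (f u - y)`, `y' = 1`, rescaled to a bounded vector field. -/
noncomputable def leafField (f : Polynomial ℝ) (z : ℝ × ℝ) : ℝ × ℝ :=
  (2 * (f.eval z.1 - z.2) * (1 + (f.eval z.1 - z.2) ^ 2)⁻¹, (1 + (f.eval z.1 - z.2) ^ 2)⁻¹)

theorem contDiff_polynomial_eval (f : Polynomial ℝ) (n : WithTop ℕ∞) :
    ContDiff ℝ n (fun x : ℝ => f.eval x) := by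
  simpa [Polynomial.aeval_def, Polynomial.eval₂_eq_eval_map] using f.contDiff_aeval (𝕜 := ℝ) n

theorem contDiff_leafField (f : Polynomial ℝ) (n : WithTop ℕ∞) : ContDiff ℝ n (leafField f) := by
  have h : ContDiff ℝ n (fun z : ℝ × ℝ => f.eval z.1 - z.2) :=
    ((contDiff_polynomial_eval f n).comp contDiff_fst).sub contDiff_snd
  have h2 : ContDiff ℝ n (fun z : ℝ × ℝ => (1 + (f.eval z.1 - z.2) ^ 2)⁻¹) :=
    (contDiff_const.add (h.pow 2)).inv fun z => by positivity
  exact ((contDiff_const.mul h).mul h2).prodMk h2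

theorem norm_leafField_le (f : Polynomial ℝ) (z : ℝ × ℝ) : ‖leafField f z‖ ≤ 1 := by
  rw [leafField, Prod.norm_def]
  set g := f.eval z.1 - z.2
  have h : 0 < 1 + g ^ 2 := by positivity
  refine max_le ?_ ?_
  · rw [← div_eq_mul_inv, Real.norm_eq_abs, abs_div, abs_of_pos h, div_le_one h, abs_le]
    constructor <;> nlinarith [sq_nonneg (g - 1), sq_nonneg (g + 1)]
  · rw [Real.norm_eq_abs, abs_inv, abs_of_pos h]
    exact inv_le_one_of_one_le₀ (by nlinarith [sq_nonneg g])

theorem contDiff_aeval_normedAlgebra {A : Type*} [NormedCommRing A] [NormedAlgebra ℝ A]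
    (f : Polynomial ℝ) (n : WithTop ℕ∞) : ContDiff ℝ n (fun a : A => Polynomial.aeval a f) := by
  induction f using Polynomial.induction_on' with
  | add p q hp hq => simpa using hp.add hq
  | monomial k r =>
    simp only [Polynomial.aeval_monomial]
    exact contDiff_const.mul (contDiff_id.pow k)

/-- The field is rational with nonvanishing denominator, so composition with it uses only polynomial
operations and inversion in the Banach algebra `C(I, ℝ)`, all analytic. -/
theorem exists_superposition_leafField (f : Polynomial ℝ) :
    ∃ V : C(I, ℝ × ℝ) → C(I, ℝ × ℝ), (∀ φ t, V φ t = leafField f (φ t)) ∧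
      ∀ φ, ContDiffAt ℝ ω V φ := by
  let P₁ : C(I, ℝ × ℝ) →L[ℝ] C(I, ℝ) := (ContinuousLinearMap.fst ℝ ℝ ℝ).compLeftContinuous ℝ I
  let P₂ : C(I, ℝ × ℝ) →L[ℝ] C(I, ℝ) := (ContinuousLinearMap.snd ℝ ℝ ℝ).compLeftContinuous ℝ I
  let J₁ : C(I, ℝ) →L[ℝ] C(I, ℝ × ℝ) := (ContinuousLinearMap.inl ℝ ℝ ℝ).compLeftContinuous ℝ I
  let J₂ : C(I, ℝ) →L[ℝ] C(I, ℝ × ℝ) := (ContinuousLinearMap.inr ℝ ℝ ℝ).compLeftContinuous ℝ I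
  let g : C(I, ℝ × ℝ) → C(I, ℝ) := fun φ => Polynomial.aeval (P₁ φ) f - P₂ φ
  have hgt : ∀ φ t, g φ t = f.eval (φ t).1 - (φ t).2 := fun φ t => by
    have : (Polynomial.aeval (P₁ φ) f) t = f.eval ((P₁ φ) t) := by
      rw [Polynomial.aeval_continuousMap_apply]
    simp only [g, ContinuousMap.sub_apply, this]
    rfl
  have hg : ContDiff ℝ ω g :=
    ((contDiff_aeval_normedAlgebra f ω).comp P₁.contDiff).sub P₂.contDiff
  have hu : ∀ φ, IsUnit (1 + g φ ^ 2) := fun φ => by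
    rw [ContinuousMap.isUnit_iff_forall_ne_zero]
    intro t
    simp only [ContinuousMap.add_apply, ContinuousMap.one_apply, ContinuousMap.pow_apply]
    positivity
  have hN : ∀ φ, ContDiffAt ℝ ω (fun φ => Ring.inverse (1 + g φ ^ 2)) φ := fun φ => by
    obtain ⟨a, ha⟩ := hu φ
    have h1 : ContDiffAt ℝ ω (fun φ => 1 + g φ ^ 2) φ := (contDiff_const.add (hg.pow 2)).contDiffAt
    have h2 := contDiffAt_ringInverse ℝ (n := ω) a
    rw [ha] at h2
    exact h2.comp φ h1
  have hNt : ∀ φ t, (Ring.inverse (1 + g φ ^ 2) : C(I, ℝ)) t = (1 + (f.eval (φ t).1 - (φ t).2) ^ 2)⁻¹ :=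
    fun φ t => by
    have h := congrArg (fun a : C(I, ℝ) => a t) (Ring.mul_inverse_cancel _ (hu φ))
    simp only [ContinuousMap.mul_apply, ContinuousMap.add_apply, ContinuousMap.one_apply,
      ContinuousMap.pow_apply, hgt] at h
    exact eq_inv_of_mul_eq_one_right h
  refine ⟨fun φ => J₁ (2 * g φ * Ring.inverse (1 + g φ ^ 2)) + J₂ (Ring.inverse (1 + g φ ^ 2)),
    fun φ t => ?_, fun φ => ?_⟩
  · have e₁ : ∀ a t, J₁ a t = (a t, 0) := fun _ _ => rfl
    have e₂ : ∀ a t, J₂ a t = (0, a t) := fun _ _ => rfl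
    rw [ContinuousMap.add_apply, e₁, e₂, ContinuousMap.mul_apply, ContinuousMap.mul_apply, hNt, hgt]
    simp only [leafField, Prod.mk_add_mk, add_zero, zero_add]
    rfl
  · exact (J₁.contDiff.contDiffAt.comp φ
      ((contDiff_const.mul hg).contDiffAt.mul (hN φ))).add (J₂.contDiff.contDiffAt.comp φ (hN φ))

/-- The flow of the rescaled direction field. -/
noncomputable def leafFlow (f : Polynomial ℝ) (z : ℝ × ℝ) : ℝ → ℝ × ℝ :=
  (exists_integralCurve_of_bounded (contDiff_leafField f 1) (norm_leafField_le f) z).choose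

theorem leafFlow_zero (f : Polynomial ℝ) (z : ℝ × ℝ) : leafFlow f z 0 = z :=
  (exists_integralCurve_of_bounded (contDiff_leafField f 1) (norm_leafField_le f) z).choose_spec.1

theorem hasDerivAt_leafFlow (f : Polynomial ℝ) (z : ℝ × ℝ) (t : ℝ) :
    HasDerivAt (leafFlow f z) (leafField f (leafFlow f z t)) t :=
  (exists_integralCurve_of_bounded (contDiff_leafField f 1) (norm_leafField_le f) z).choose_spec.2 t

theorem leafFlow_leafFlow (f : Polynomial ℝ) (z : ℝ × ℝ) (s t : ℝ) :
    leafFlow f (leafFlow f z s) t = leafFlow f z (s + t) := by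
  have h : ∀ t, HasDerivAt (fun t => leafFlow f z (s + t)) (leafField f (leafFlow f z (s + t))) t :=
    fun t => (hasDerivAt_leafFlow f z (s + t)).comp_const_add s t
  exact congrFun (integralCurve_unique (contDiff_leafField f 1) (hasDerivAt_leafFlow f _) h
    (t₀ := 0) (by rw [leafFlow_zero, add_zero])) t

theorem contDiffAt_leafFlow (f : Polynomial ℝ) (z : ℝ × ℝ) :
    ContDiffAt ℝ ω (fun p : (ℝ × ℝ) × ℝ => leafFlow f p.1 p.2) (z, 0) := by
  obtain ⟨V, hV, hVd⟩ := exists_superposition_leafField f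
  exact contDiffAt_flow_of_superposition (norm_leafField_le f) hV (hVd _) (leafFlow_zero f)
    (hasDerivAt_leafFlow f)

theorem hasDerivAt_leafFlow_fst (f : Polynomial ℝ) (z : ℝ × ℝ) (t : ℝ) :
    HasDerivAt (fun t => (leafFlow f z t).1) (leafField f (leafFlow f z t)).1 t :=
  (hasDerivAt_leafFlow f z t).fst

theorem hasDerivAt_leafFlow_snd (f : Polynomial ℝ) (z : ℝ × ℝ) (t : ℝ) :
    HasDerivAt (fun t => (leafFlow f z t).2) (leafField f (leafFlow f z t)).2 t :=
  (hasDerivAt_leafFlow f z t).snd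

theorem leafField_snd_pos (f : Polynomial ℝ) (z : ℝ × ℝ) : 0 < (leafField f z).2 := by
  simp only [leafField]; positivity

theorem leafField_fst (f : Polynomial ℝ) (z : ℝ × ℝ) :
    (leafField f z).1 = 2 * (f.eval z.1 - z.2) * (leafField f z).2 := rfl

theorem strictMono_leafFlow_snd (f : Polynomial ℝ) (z : ℝ × ℝ) :
    StrictMono fun t => (leafFlow f z t).2 :=
  strictMono_of_hasDerivAt_pos (hasDerivAt_leafFlow_snd f z) fun _ => leafField_snd_pos f _

/-- Starting at zero, `ρ` remains nonpositive, so the left difference quotients at a second zero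
would be nonnegative. -/
theorem not_two_zeros_of_deriv_neg {ρ ρ' : ℝ → ℝ} (h : ∀ t, HasDerivAt ρ (ρ' t) t) {a b : ℝ}
    (hab : a < b) (ha : ρ a = 0) (hb : ρ b = 0)
    (hneg : ∀ t ∈ Set.Icc a b, ρ t = 0 → ρ' t < 0) : False := by
  have hle : ∀ ⦃t⦄, t ∈ Set.Icc a b → ρ t ≤ 0 :=
    image_le_of_deriv_right_lt_deriv_boundary (f' := ρ') (B := fun _ => 0) (B' := fun _ => 0)
      (fun t _ => (h t).continuousAt.continuousWithinAt) (fun t _ => (h t).hasDerivWithinAt) ha.le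
      (fun t => hasDerivAt_const t 0) (fun t ht => hneg t (Set.Ico_subset_Icc_self ht))
  have hs := (hasDerivAt_iff_tendsto_slope.1 (h b)).mono_left
    (nhdsWithin_mono b (fun x (hx : x < b) => hx.ne) : 𝓝[<] b ≤ 𝓝[≠] b)
  have : 0 ≤ ρ' b := by
    refine ge_of_tendsto hs ?_
    filter_upwards [Ioo_mem_nhdsLT hab] with t ht
    rw [slope_def_field, hb, sub_zero]
    exact div_nonneg_of_nonpos (hle (Set.Ioo_subset_Icc_self ht)) (sub_nonpos.2 ht.2.le)
  exact absurd (hneg b (Set.right_mem_Icc.2 hab.le) hb) this.not_gt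

/-- Barrier principle that keeps leaves in `u ≥ 0`: on `u = 0` the direction field points inward
where `y < f(0)`. The time-reversed version below serves where `y > f(0)`. -/
theorem nonneg_of_deriv_pos_at_zero {u u' : ℝ → ℝ} (h : ∀ t, HasDerivAt u (u' t) t) {a b : ℝ}
    (hab : a ≤ b) (ha : 0 ≤ u a) (hpos : ∀ t ∈ Set.Ico a b, u t = 0 → 0 < u' t) : 0 ≤ u b := by
  have := image_le_of_deriv_right_lt_deriv_boundary (f := fun t => - u t) (f' := fun t => - u' t)
    (B := fun _ => 0) (B' := fun _ => 0) (a := a) (b := b)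
    (fun t _ => (h t).neg.continuousAt.continuousWithinAt)
    (fun t _ => (h t).neg.hasDerivWithinAt) (by simpa using ha)
    (fun t => hasDerivAt_const t 0)
    (fun t ht h0 => by simpa using hpos t ht (by simpa using h0)) (Set.right_mem_Icc.2 hab)
  simpa using this

theorem nonneg_of_deriv_neg_at_zero {u u' : ℝ → ℝ} (h : ∀ t, HasDerivAt u (u' t) t) {a b : ℝ}
    (hab : a ≤ b) (hb : 0 ≤ u b) (hneg : ∀ t ∈ Set.Ioc a b, u t = 0 → u' t < 0) : 0 ≤ u a := by
  have h' : ∀ t, HasDerivAt (fun s => u (-s)) (- u' (-t)) t := fun t => by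
    simpa using! (h (-t)).comp t (hasDerivAt_neg t)
  have := nonneg_of_deriv_pos_at_zero h' (neg_le_neg hab) (by simpa using hb)
    (fun t ht h0 => by
      simpa using hneg (-t) ⟨by linarith [ht.2], by linarith [ht.1]⟩ h0)
  simpa using this

/-! ### Every leaf through the half plane meets a transversal ray -/

section LeafCrossing

variable {f : Polynomial ℝ}

theorem exists_leafField_snd_ge {K : Set (ℝ × ℝ)} (hK : IsCompact K) :
    ∃ m > 0, ∀ z ∈ K, m ≤ (leafField f z).2 := by
  rcases K.eq_empty_or_nonempty with rfl | hne
  · exact ⟨1, one_pos, by simp⟩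
  obtain ⟨z, hz, hmin⟩ := hK.exists_isMinOn hne
    ((contDiff_leafField f 0).continuous.snd.continuousOn)
  exact ⟨_, leafField_snd_pos f z, fun w hw => hmin hw⟩

/-- On a compact set `y'` has a positive lower bound, so a leaf staying there would have unbounded
`y`. -/
theorem exists_leafFlow_notMem_of_nonneg {K : Set (ℝ × ℝ)} (hK : IsCompact K) (z : ℝ × ℝ) :
    ∃ t ≥ 0, leafFlow f z t ∉ K := by
  by_contra! hcon
  obtain ⟨m, hm, hmK⟩ := exists_leafField_snd_ge (f := f) hK
  obtain ⟨B, hB⟩ := (hK.image continuous_snd).bddAbove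
  have hlin : ∀ t ≥ 0, m * (t - 0) ≤ (leafFlow f z t).2 - (leafFlow f z 0).2 := fun t ht =>
    Convex.mul_sub_le_image_sub_of_le_deriv (convex_Ici (0 : ℝ))
      (fun s _ => (hasDerivAt_leafFlow_snd f z s).continuousAt.continuousWithinAt)
      (fun s _ => (hasDerivAt_leafFlow_snd f z s).differentiableAt.differentiableWithinAt)
      (fun s hs => by
        rw [(hasDerivAt_leafFlow_snd f z s).deriv]
        exact hmK _ (hcon s (interior_subset hs)))
      0 Set.self_mem_Ici t ht ht
  have hb0 : z.2 ≤ B := hB ⟨z, by simpa [leafFlow_zero] using hcon 0 le_rfl, rfl⟩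
  have ht : 0 ≤ (B - z.2 + 1) / m := div_nonneg (by linarith) hm.le
  have h1 := hlin _ ht
  have h2 : (leafFlow f z ((B - z.2 + 1) / m)).2 ≤ B := hB ⟨_, hcon _ ht, rfl⟩
  rw [sub_zero, mul_div_cancel₀ _ hm.ne', leafFlow_zero] at h1
  linarith

theorem exists_leafFlow_notMem_of_nonpos {K : Set (ℝ × ℝ)} (hK : IsCompact K) (z : ℝ × ℝ) :
    ∃ t ≤ 0, leafFlow f z t ∉ K := by
  by_contra! hcon
  obtain ⟨m, hm, hmK⟩ := exists_leafField_snd_ge (f := f) hK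
  obtain ⟨B, hB⟩ := (hK.image continuous_snd).bddBelow
  have hlin : ∀ t ≤ 0, m * (0 - t) ≤ (leafFlow f z 0).2 - (leafFlow f z t).2 := fun t ht =>
    Convex.mul_sub_le_image_sub_of_le_deriv (convex_Iic (0 : ℝ))
      (fun s _ => (hasDerivAt_leafFlow_snd f z s).continuousAt.continuousWithinAt)
      (fun s _ => (hasDerivAt_leafFlow_snd f z s).differentiableAt.differentiableWithinAt)
      (fun s hs => by
        rw [(hasDerivAt_leafFlow_snd f z s).deriv]
        exact hmK _ (hcon s (interior_subset hs : s ∈ Set.Iic (0 : ℝ))))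
      t ht 0 Set.self_mem_Iic ht
  have hb0 : B ≤ z.2 := hB ⟨z, by simpa [leafFlow_zero] using hcon 0 le_rfl, rfl⟩
  have ht : -((z.2 - B + 1) / m) ≤ 0 := neg_nonpos.2 (div_nonneg (by linarith) hm.le)
  have h1 := hlin _ ht
  have h2 : B ≤ (leafFlow f z (-((z.2 - B + 1) / m))).2 := hB ⟨_, hcon _ ht, rfl⟩
  rw [zero_sub, neg_neg, mul_div_cancel₀ _ hm.ne', leafFlow_zero] at h1
  linarith

theorem continuous_leafFlow (f : Polynomial ℝ) (z : ℝ × ℝ) : Continuous (leafFlow f z) :=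
  continuous_iff_continuousAt.2 fun t => (hasDerivAt_leafFlow f z t).continuousAt

variable {M : ℝ} (hM : ∀ u, 0 ≤ u → f.eval u ≤ M)
include hM

/-- Up to the positive rescaling factor, `u + (y - M)²` has derivative `2(f(u) - M) ≤ 0`. -/
theorem leafFlow_fst_le {z : ℝ × ℝ} {T : ℝ} (hT : 0 ≤ T)
    (h : ∀ t ∈ Set.Icc 0 T, 0 ≤ (leafFlow f z t).1) :
    (leafFlow f z T).1 ≤ z.1 + (z.2 - M) ^ 2 := by
  have hd : ∀ t, HasDerivAt (fun t => (leafFlow f z t).1 + ((leafFlow f z t).2 - M) ^ 2)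
      ((leafField f (leafFlow f z t)).1 +
        2 * ((leafFlow f z t).2 - M) * (leafField f (leafFlow f z t)).2) t := fun t => by
    have := (hasDerivAt_leafFlow_fst f z t).add
      (((hasDerivAt_leafFlow_snd f z t).sub_const M).pow 2)
    simpa using! this
  have hanti : AntitoneOn (fun t => (leafFlow f z t).1 + ((leafFlow f z t).2 - M) ^ 2)
      (Set.Icc 0 T) := by
    refine antitoneOn_of_deriv_nonpos (convex_Icc 0 T)
      (fun t _ => (hd t).continuousAt.continuousWithinAt)
      (fun t _ => (hd t).differentiableAt.differentiableWithinAt) fun t ht => ?_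
    rw [(hd t).deriv, leafField_fst]
    have h1 := hM _ (h t (interior_subset ht))
    have h2 := leafField_snd_pos f (leafFlow f z t)
    nlinarith
  have := hanti (Set.left_mem_Icc.2 hT) (Set.right_mem_Icc.2 hT) hT
  simp only [leafFlow_zero] at this
  nlinarith [sq_nonneg ((leafFlow f z T).2 - M)]

/-- While `y < f(0)` the line `u = 0` is a barrier and `u` is bounded, so the leaf can leave its
compact box only through `y = f(0)`. -/
theorem exists_leafFlow_snd_eq {z : ℝ × ℝ} (hz1 : 0 ≤ z.1) (hz2 : z.2 ≤ f.eval 0) :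
    ∃ t, (leafFlow f z t).2 = f.eval 0 ∧ 0 ≤ (leafFlow f z t).1 := by
  have hmono := strictMono_leafFlow_snd f z
  have hbar : ∀ T, 0 ≤ T → (∀ t ∈ Set.Ico 0 T, (leafFlow f z t).2 < f.eval 0) →
      0 ≤ (leafFlow f z T).1 := fun T hT h =>
    nonneg_of_deriv_pos_at_zero (hasDerivAt_leafFlow_fst f z) hT (by rwa [leafFlow_zero])
      fun t ht h0 => by
        rw [leafField_fst, h0]
        have := h t ht
        exact mul_pos (by linarith) (leafField_snd_pos f _)
  by_cases hex : ∃ t ≥ 0, (leafFlow f z t).2 = f.eval 0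
  · obtain ⟨t, ht, he⟩ := hex
    exact ⟨t, he, hbar t ht fun s hs => he ▸ hmono hs.2⟩
  exfalso
  push Not at hex
  have hlt : ∀ t ≥ 0, (leafFlow f z t).2 < f.eval 0 := fun t ht => by
    by_contra! hge
    obtain ⟨s, hs, he⟩ := intermediate_value_Icc ht (continuous_leafFlow f z).snd.continuousOn
      ⟨by rwa [leafFlow_zero], hge⟩
    exact hex s hs.1 he
  have hu : ∀ t ≥ 0, 0 ≤ (leafFlow f z t).1 := fun t ht => hbar t ht fun s hs => hlt s hs.1
  obtain ⟨t, ht, hK⟩ := exists_leafFlow_notMem_of_nonneg (f := f)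
    ((isCompact_Icc (a := (0 : ℝ)) (b := z.1 + (z.2 - M) ^ 2)).prod
      (isCompact_Icc (a := z.2) (b := f.eval 0))) z
  refine hK ⟨⟨hu t ht, leafFlow_fst_le hM ht fun s hs => hu s hs.1⟩, ?_, (hlt t ht).le⟩
  have := hmono.monotone ht
  simpa only [leafFlow_zero] using this

/-- A forward leaf that stayed right of the ray would satisfy `k(y - f(0)) < u`, so the bound on `u`
would also bound `y` and confine the leaf to a compact box. -/
theorem exists_crossing_of_right {k : ℝ} (hk : 0 < k) {z : ℝ × ℝ} (hz2 : f.eval 0 ≤ z.2)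
    (hz : k * (z.2 - f.eval 0) ≤ z.1) :
    ∃ t, f.eval 0 ≤ (leafFlow f z t).2 ∧
      (leafFlow f z t).1 = k * ((leafFlow f z t).2 - f.eval 0) := by
  have hmono := strictMono_leafFlow_snd f z
  have hy : ∀ t ≥ 0, z.2 ≤ (leafFlow f z t).2 := fun t ht => by
    have := hmono.monotone ht
    simpa only [leafFlow_zero] using this
  by_contra! hcon
  have hpos : ∀ t ≥ 0, k * ((leafFlow f z t).2 - f.eval 0) < (leafFlow f z t).1 := fun t ht => by
    by_contra! hle
    have hc : Continuous fun t => (leafFlow f z t).1 - k * ((leafFlow f z t).2 - f.eval 0) := by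
      have := continuous_leafFlow f z
      fun_prop
    obtain ⟨s, hs, he⟩ := intermediate_value_Icc' ht hc.continuousOn
      (show (0 : ℝ) ∈ _ from ⟨by linarith, by rw [leafFlow_zero]; linarith⟩)
    exact hcon s (hz2.trans (hy s hs.1)) (sub_eq_zero.1 he)
  have hu : ∀ t ≥ 0, 0 ≤ (leafFlow f z t).1 := fun t ht =>
    (mul_nonneg hk.le (by linarith [hy t ht])).trans (hpos t ht).le
  obtain ⟨t, ht, hK⟩ := exists_leafFlow_notMem_of_nonneg (f := f)
    ((isCompact_Icc (a := (0 : ℝ)) (b := z.1 + (z.2 - M) ^ 2)).prod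
      (isCompact_Icc (a := z.2) (b := (z.1 + (z.2 - M) ^ 2) / k + f.eval 0))) z
  have hle := leafFlow_fst_le hM ht fun s hs => hu s hs.1
  refine hK ⟨⟨hu t ht, hle⟩, hy t ht, ?_⟩
  rw [← sub_le_iff_le_add, le_div_iff₀ hk]
  linarith [hpos t ht]

omit hM in
-- Followed backward, the leaf lies in the bounded triangle between `u = 0` and the ray, with `u =
-- 0` a barrier. No bound on `f` is needed here.
theorem exists_crossing_of_left {k : ℝ} (hk : 0 < k) {z : ℝ × ℝ} (hz1 : 0 ≤ z.1)
    (hz2 : f.eval 0 ≤ z.2) (hz : z.1 ≤ k * (z.2 - f.eval 0)) :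
    ∃ t, f.eval 0 ≤ (leafFlow f z t).2 ∧
      (leafFlow f z t).1 = k * ((leafFlow f z t).2 - f.eval 0) := by
  have hmono := strictMono_leafFlow_snd f z
  have hc : Continuous fun t => (leafFlow f z t).1 - k * ((leafFlow f z t).2 - f.eval 0) := by
    have := continuous_leafFlow f z
    fun_prop
  have hivt : ∀ T ≤ 0, f.eval 0 ≤ (leafFlow f z T).2 →
      k * ((leafFlow f z T).2 - f.eval 0) ≤ (leafFlow f z T).1 →
      ∃ t, f.eval 0 ≤ (leafFlow f z t).2 ∧
      (leafFlow f z t).1 = k * ((leafFlow f z t).2 - f.eval 0) := fun T hT h1 h2 => by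
    obtain ⟨s, hs, he⟩ := intermediate_value_Icc' hT hc.continuousOn
      (show (0 : ℝ) ∈ _ from ⟨by rw [leafFlow_zero]; linarith, by linarith⟩)
    exact ⟨s, h1.trans (hmono.monotone hs.1), sub_eq_zero.1 he⟩
  have hbar : ∀ T, T ≤ 0 → (∀ t ∈ Set.Ioc T 0, f.eval 0 < (leafFlow f z t).2) →
      0 ≤ (leafFlow f z T).1 := fun T hT h =>
    nonneg_of_deriv_neg_at_zero (hasDerivAt_leafFlow_fst f z) hT (by rwa [leafFlow_zero])
      fun t ht h0 => by
        rw [leafField_fst, h0]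
        have := h t ht
        exact mul_neg_of_neg_of_pos (by linarith) (leafField_snd_pos f _)
  by_cases hex : ∃ t ≤ 0, (leafFlow f z t).2 = f.eval 0
  · obtain ⟨t, ht, he⟩ := hex
    refine hivt t ht he.ge ?_
    rw [he, sub_self, mul_zero]
    exact hbar t ht fun s hs => he ▸ hmono hs.1
  push Not at hex
  have hlt : ∀ t ≤ 0, f.eval 0 < (leafFlow f z t).2 := fun t ht => by
    by_contra! hge
    obtain ⟨s, hs, he⟩ := intermediate_value_Icc ht (continuous_leafFlow f z).snd.continuousOn
      ⟨hge, by rwa [leafFlow_zero]⟩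
    exact hex s hs.2 he
  have hu : ∀ t ≤ 0, 0 ≤ (leafFlow f z t).1 := fun t ht => hbar t ht fun s hs => hlt s hs.2
  obtain ⟨t, ht, hK⟩ := exists_leafFlow_notMem_of_nonpos (f := f)
    ((isCompact_Icc (a := (0 : ℝ)) (b := k * (z.2 - f.eval 0))).prod
      (isCompact_Icc (a := f.eval 0) (b := z.2))) z
  have hy : (leafFlow f z t).2 ≤ z.2 := by
    have := hmono.monotone ht
    simpa only [leafFlow_zero] using this
  refine hivt t ht (hlt t ht).le ?_
  by_contra! hgt
  refine hK ⟨⟨hu t ht, hgt.le.trans ?_⟩, (hlt t ht).le, hy⟩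
  exact mul_le_mul_of_nonneg_left (by linarith) hk.le

theorem exists_crossing {k : ℝ} (hk : 0 < k) {z : ℝ × ℝ} (hz1 : 0 ≤ z.1) :
    ∃ t w, 0 ≤ w ∧ leafFlow f z t = (k * w, f.eval 0 + w) := by
  have hmain : ∀ z : ℝ × ℝ, 0 ≤ z.1 → f.eval 0 ≤ z.2 →
      ∃ t w, 0 ≤ w ∧ leafFlow f z t = (k * w, f.eval 0 + w) := fun z h1 h2 => by
    obtain ⟨t, ht1, ht2⟩ := (le_total (k * (z.2 - f.eval 0)) z.1).elim
      (exists_crossing_of_right hM hk h2) (exists_crossing_of_left hk h1 h2)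
    exact ⟨t, (leafFlow f z t).2 - f.eval 0, by linarith, Prod.ext ht2 (by simp)⟩
  rcases le_total (f.eval 0) z.2 with h | h
  · exact hmain z hz1 h
  · obtain ⟨s, hs1, hs2⟩ := exists_leafFlow_snd_eq hM hz1 h
    obtain ⟨t, w, hw, he⟩ := hmain _ hs2 hs1.ge
    exact ⟨s + t, w, hw, by rw [← leafFlow_leafFlow, he]⟩

/-- The upper bound and differentiability at `0` give `f(u) - f(0) ≤ C|u|` for `u ≥ -1`. With `k =
1/(2C)` the expression is at most `|w| - 2w - k`, which is negative for `w > -k/3`. The margin `δ =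
k/3` makes `w = 0` an interior parameter. -/
theorem exists_transversal_ray :
    ∃ k > 0, ∃ δ > 0, ∀ w > -δ, 2 * (f.eval (k * w) - (f.eval 0 + w)) - k < 0 := by
  obtain ⟨C₀, hC₀⟩ := (isCompact_Icc (a := (-1 : ℝ)) (b := 1)).exists_bound_of_continuousOn
    (f.divX.continuous.continuousOn)
  set C := max (max C₀ |M - f.eval 0|) 1 with hC
  have hC1 : 1 ≤ C := le_max_right _ _
  have hf : ∀ u, f.eval u = u * f.divX.eval u + f.eval 0 := fun u => by
    conv_lhs => rw [← f.divX_mul_X_add]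
    simp [Polynomial.coeff_zero_eq_eval_zero, mul_comm]
  have hup : ∀ u ≥ -1, f.eval u - f.eval 0 ≤ C * |u| := fun u hu => by
    rcases le_total u 1 with h1 | h1
    · have h2 : |f.divX.eval u| ≤ C :=
        (hC₀ u ⟨hu, h1⟩).trans ((le_max_left _ _).trans (le_max_left _ _))
      rw [hf u, add_sub_cancel_right]
      refine (le_abs_self _).trans ?_
      rw [abs_mul, mul_comm]
      exact mul_le_mul_of_nonneg_right h2 (abs_nonneg _)
    · have h2 : |M - f.eval 0| ≤ C := (le_max_right _ _).trans (le_max_left _ _)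
      have h3 := hM u (by linarith)
      rw [abs_of_nonneg (by linarith : (0 : ℝ) ≤ u)]
      nlinarith [le_abs_self (M - f.eval 0)]
  have hk : 0 < 1 / (2 * C) := by positivity
  have hk1 : 1 / (2 * C) ≤ 1 := by rw [div_le_one (by positivity)]; linarith
  have hkC : C * (1 / (2 * C)) = 1 / 2 := by field_simp
  refine ⟨1 / (2 * C), hk, 1 / (2 * C) / 3, by positivity, fun w hw => ?_⟩
  set k := 1 / (2 * C)
  have hkw : -1 ≤ k * w := by nlinarith
  have h1 := hup _ hkw
  rw [abs_mul, abs_of_pos hk, ← mul_assoc, hkC] at h1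
  rcases abs_cases w with ⟨h2, _⟩ | ⟨h2, _⟩ <;> rw [h2] at h1 <;> linarith

end LeafCrossing

/-- Along a leaf `u - k(y - f(0))` decreases strictly at each zero with `w > -δ`. As `y` increases,
this condition persists after the first crossing, so there is no second one. -/
theorem crossing_unique {f : Polynomial ℝ} {k δ : ℝ}
    (hδ : ∀ w > -δ, 2 * (f.eval (k * w) - (f.eval 0 + w)) - k < 0) {z : ℝ × ℝ}
    {t₁ t₂ w₁ w₂ : ℝ} (hw₁ : -δ < w₁) (hw₂ : -δ < w₂)
    (h₁ : leafFlow f z t₁ = (k * w₁, f.eval 0 + w₁))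
    (h₂ : leafFlow f z t₂ = (k * w₂, f.eval 0 + w₂)) : w₁ = w₂ := by
  wlog hlt : t₁ < t₂ generalizing t₁ t₂ w₁ w₂
  · rcases (not_lt.1 hlt).eq_or_lt with rfl | h
    · simpa using congrArg Prod.snd (h₁.symm.trans h₂)
    · exact (this hw₂ hw₁ h₂ h₁ h).symm
  exfalso
  have hd : ∀ t, HasDerivAt
      (fun t => (leafFlow f z t).1 - k * ((leafFlow f z t).2 - f.eval 0))
      ((leafField f (leafFlow f z t)).1 - k * (leafField f (leafFlow f z t)).2) t := fun t =>
    (hasDerivAt_leafFlow_fst f z t).sub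
      (((hasDerivAt_leafFlow_snd f z t).sub_const (f.eval 0)).const_mul k)
  refine not_two_zeros_of_deriv_neg hd hlt (by simp [h₁]) (by simp [h₂]) fun t ht h0 => ?_
  have hy := (strictMono_leafFlow_snd f z).monotone ht.1
  simp only [h₁] at hy
  have h3 := hδ ((leafFlow f z t).2 - f.eval 0) (by linarith)
  rw [leafField_fst, sub_eq_zero.1 h0]
  have := leafField_snd_pos f (leafFlow f z t)
  nlinarith

/-! ### The crossing parameter as an analytic first integral -/

/-- The parameter of the point at which the leaf through a given point meets the transversal
ray `w ↦ (k w, f 0 + w)`, `w > -δ`. -/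
noncomputable def leafCoordinate (f : Polynomial ℝ) (k δ : ℝ) (z : ℝ × ℝ) : ℝ :=
  Classical.epsilon fun w => -δ < w ∧ ∃ t, leafFlow f z t = (k * w, f.eval 0 + w)

theorem leafCoordinate_leafFlow (f : Polynomial ℝ) (k δ : ℝ) (z : ℝ × ℝ) (s : ℝ) :
    leafCoordinate f k δ (leafFlow f z s) = leafCoordinate f k δ z := by
  unfold leafCoordinate
  congr 1
  funext w
  refine propext (and_congr_right fun _ => ⟨fun ⟨t, ht⟩ => ⟨s + t, ?_⟩, fun ⟨t, ht⟩ => ⟨t - s, ?_⟩⟩)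
  · rw [← leafFlow_leafFlow, ht]
  · rw [leafFlow_leafFlow, add_sub_cancel, ht]

section

variable {f : Polynomial ℝ} {k δ : ℝ}

theorem leafCoordinate_eq (hδ : ∀ w > -δ, 2 * (f.eval (k * w) - (f.eval 0 + w)) - k < 0)
    {z : ℝ × ℝ} {t w : ℝ} (hw : -δ < w) (h : leafFlow f z t = (k * w, f.eval 0 + w)) :
    leafCoordinate f k δ z = w := by
  obtain ⟨h1, s, h2⟩ := Classical.epsilon_spec
    (p := fun w => -δ < w ∧ ∃ t, leafFlow f z t = (k * w, f.eval 0 + w)) ⟨w, hw, t, h⟩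
  exact crossing_unique hδ h1 hw h2 h

/-- Flowing off the ray gives a map `(w, t) ↦ z` whose differential is invertible by transversality;
near the ray the coordinate is the first component of its analytic local inverse. -/
theorem contDiffAt_leafCoordinate_ray
    (hδ : ∀ w > -δ, 2 * (f.eval (k * w) - (f.eval 0 + w)) - k < 0) {w₀ : ℝ} (hw₀ : -δ < w₀) :
    ContDiffAt ℝ ω (leafCoordinate f k δ) (k * w₀, f.eval 0 + w₀) := by
  let Ξ : ℝ × ℝ → ℝ × ℝ := fun p => leafFlow f (k * p.1, f.eval 0 + p.1) p.2
  have hΞ0 : Ξ (w₀, 0) = (k * w₀, f.eval 0 + w₀) := leafFlow_zero f _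
  have hΞ : ContDiffAt ℝ ω Ξ (w₀, 0) :=
    ContDiffAt.comp (w₀, (0 : ℝ)) (g := fun p : (ℝ × ℝ) × ℝ => leafFlow f p.1 p.2)
      (f := fun p : ℝ × ℝ => ((k * p.1, f.eval 0 + p.1), p.2))
      (contDiffAt_leafFlow f _) (by fun_prop)
  have hω : (ω : WithTop ℕ∞) ≠ 0 := by simp
  have hD := (hΞ.differentiableAt hω).hasFDerivAt
  set D := fderiv ℝ Ξ (w₀, 0)
  set a := (leafField f (k * w₀, f.eval 0 + w₀)).1 with ha
  set b := (leafField f (k * w₀, f.eval 0 + w₀)).2 with hb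
  have hD1 : D (1, 0) = (k, 1) := by
    have h1 : HasDerivAt (fun w : ℝ => (w, (0 : ℝ))) ((1 : ℝ), (0 : ℝ)) w₀ :=
      (hasDerivAt_id w₀).prodMk (hasDerivAt_const w₀ 0)
    have h2 : HasDerivAt (fun w : ℝ => (k * w, f.eval 0 + w)) (k, 1) w₀ := by
      simpa using ((hasDerivAt_id w₀).const_mul k).prodMk ((hasDerivAt_id w₀).const_add (f.eval 0))
    have h3 := hD.comp_hasDerivAt w₀ h1
    have e : (Ξ ∘ fun w : ℝ => (w, (0 : ℝ))) = fun w : ℝ => (k * w, f.eval 0 + w) := by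
      funext w; exact leafFlow_zero f _
    rw [e] at h3
    exact h3.unique h2
  have hD2 : D (0, 1) = (a, b) := by
    have h1 : HasDerivAt (fun t : ℝ => (w₀, t)) ((0 : ℝ), (1 : ℝ)) 0 :=
      (hasDerivAt_const 0 w₀).prodMk (hasDerivAt_id 0)
    have h2 := hasDerivAt_leafFlow f (k * w₀, f.eval 0 + w₀) 0
    rw [leafFlow_zero] at h2
    exact (hD.comp_hasDerivAt 0 h1).unique h2
  have hbpos : 0 < b := leafField_snd_pos f _
  have hab : a - k * b < 0 := by
    rw [ha, leafField_fst, ← hb]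
    have := hδ w₀ hw₀
    dsimp only
    nlinarith
  have hDv : ∀ s t : ℝ, D (s, t) = (s * k + t * a, s + t * b) := fun s t => by
    have : ((s, t) : ℝ × ℝ) = s • (1, 0) + t • (0, 1) := by simp
    rw [this, map_add, map_smul, map_smul, hD1, hD2]
    simp
  have hinj : Function.Injective D := by
    rw [injective_iff_map_eq_zero]
    rintro ⟨s, t⟩ h
    rw [hDv, Prod.mk_eq_zero] at h
    have ht : t * (a - k * b) = 0 := by linear_combination h.1 - k * h.2
    have ht0 : t = 0 := (mul_eq_zero.1 ht).resolve_right hab.ne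
    subst ht0
    simpa using h.2
  let D' : (ℝ × ℝ) ≃L[ℝ] ℝ × ℝ := (LinearEquiv.ofInjectiveEndo (D : ℝ × ℝ →ₗ[ℝ] ℝ × ℝ)
    hinj).toContinuousLinearEquiv
  have hD' : HasFDerivAt Ξ (D' : ℝ × ℝ →L[ℝ] ℝ × ℝ) (w₀, 0) := hD
  let e := hΞ.toOpenPartialHomeomorph Ξ hD' hω
  have hsrc : (w₀, (0 : ℝ)) ∈ e.source := hΞ.mem_toOpenPartialHomeomorph_source hD' hω
  have hsymm0 : e.symm (Ξ (w₀, 0)) = (w₀, 0) := e.left_inv hsrc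
  have htgt : Ξ (w₀, 0) ∈ e.target := e.map_source hsrc
  have hcd : ContDiffAt ℝ ω e.symm (Ξ (w₀, 0)) := hΞ.to_localInverse hD' hω
  rw [← hΞ0]
  refine (contDiffAt_fst.comp _ hcd : ContDiffAt ℝ ω (Prod.fst ∘ e.symm) _).congr_of_eventuallyEq ?_
  have hlim : ∀ᶠ z in 𝓝 (Ξ (w₀, 0)), -δ < (e.symm z).1 := by
    have : Filter.Tendsto (fun z => (e.symm z).1) (𝓝 (Ξ (w₀, 0))) (𝓝 w₀) := by
      have := hcd.continuousAt.fst.tendsto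
      rwa [hsymm0] at this
    exact this.eventually (lt_mem_nhds hw₀)
  filter_upwards [hlim, e.open_target.mem_nhds htgt] with z hz hzt
  have h1 : leafFlow f (k * (e.symm z).1, f.eval 0 + (e.symm z).1) (e.symm z).2 = z :=
    e.right_inv hzt
  refine leafCoordinate_eq hδ (t := -(e.symm z).2) hz ?_
  have h2 := leafFlow_leafFlow f (k * (e.symm z).1, f.eval 0 + (e.symm z).1) (e.symm z).2
    (-(e.symm z).2)
  rwa [h1, add_neg_cancel, leafFlow_zero] at h2

/-- The flow is known to be analytic only near time zero, but the coordinate is invariant under it.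
Short flow steps carry analyticity both ways between nearby points of a leaf, so it is locally
constant in time, and time is connected. -/
theorem contDiffAt_leafCoordinate_of_leafFlow {z : ℝ × ℝ} {t : ℝ}
    (h : ContDiffAt ℝ ω (leafCoordinate f k δ) (leafFlow f z t)) :
    ContDiffAt ℝ ω (leafCoordinate f k δ) z := by
  have hstep : ∀ (x : ℝ × ℝ) (s : ℝ),
      ContDiffAt ℝ ω (fun p : (ℝ × ℝ) × ℝ => leafFlow f p.1 p.2) (x, s) →
      ContDiffAt ℝ ω (leafCoordinate f k δ) (leafFlow f x s) →
      ContDiffAt ℝ ω (leafCoordinate f k δ) x := fun x s h1 h2 => by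
    have h3 : ContDiffAt ℝ ω (fun y => leafFlow f y s) x :=
      ContDiffAt.comp x (g := fun p : (ℝ × ℝ) × ℝ => leafFlow f p.1 p.2) (f := fun y => (y, s))
        h1 (by fun_prop)
    have h4 := ContDiffAt.comp x (g := leafCoordinate f k δ) h2 h3
    have e : leafCoordinate f k δ ∘ (fun y => leafFlow f y s) = leafCoordinate f k δ := by
      funext y; exact leafCoordinate_leafFlow f k δ y s
    rwa [e] at h4
  have hloc : IsLocallyConstant
      fun s => ContDiffAt ℝ ω (leafCoordinate f k δ) (leafFlow f z s) := by
    rw [IsLocallyConstant.iff_eventually_eq]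
    intro s
    have hev := (contDiffAt_leafFlow f (leafFlow f z s)).eventually (by simp)
    have t1 : Filter.Tendsto (fun r => (leafFlow f z s, r - s)) (𝓝 s)
        (𝓝 (leafFlow f z s, (0 : ℝ))) := by
      have : Continuous fun r => (leafFlow f z s, r - s) := by fun_prop
      simpa using this.tendsto s
    have t2 : Filter.Tendsto (fun r => (leafFlow f z r, s - r)) (𝓝 s)
        (𝓝 (leafFlow f z s, (0 : ℝ))) := by
      have : Continuous fun r => (leafFlow f z r, s - r) :=
        (continuous_leafFlow f z).prodMk (by fun_prop)
      simpa using this.tendsto s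
    filter_upwards [t1.eventually hev, t2.eventually hev] with r h1 h2
    refine propext ⟨fun h => hstep _ _ h1 ?_, fun h => hstep _ _ h2 ?_⟩
    · rwa [leafFlow_leafFlow, add_sub_cancel]
    · rwa [leafFlow_leafFlow, add_sub_cancel]
  have := hloc.apply_eq_of_isPreconnected isPreconnected_univ (Set.mem_univ t) (Set.mem_univ 0)
  simp only [leafFlow_zero] at this
  exact this.mp h

theorem fderiv_leafCoordinate {z : ℝ × ℝ} (h : ContDiffAt ℝ ω (leafCoordinate f k δ) z) :
    fderiv ℝ (leafCoordinate f k δ) z (2 * (f.eval z.1 - z.2), 1) = 0 := by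
  have h1 := (h.differentiableAt (by simp)).hasFDerivAt
  have h2 := hasDerivAt_leafFlow f z 0
  have h3 := HasFDerivAt.comp_hasDerivAt (l := leafCoordinate f k δ) (0 : ℝ)
    (by rw [leafFlow_zero]; exact h1) h2
  have e : leafCoordinate f k δ ∘ leafFlow f z = fun _ => leafCoordinate f k δ z := by
    funext t; exact leafCoordinate_leafFlow f k δ z t
  rw [e, leafFlow_zero] at h3
  have h4 := h3.unique (hasDerivAt_const (0 : ℝ) (leafCoordinate f k δ z))
  have hpos := leafField_snd_pos f z
  have h5 : leafField f z = (leafField f z).2 • (2 * (f.eval z.1 - z.2), (1 : ℝ)) := by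
    ext
    · simp [leafField_fst, mul_comm]
    · simp
  rw [h5, map_smul, smul_eq_mul] at h4
  exact (mul_eq_zero.1 h4).resolve_left hpos.ne'

end

theorem exists_leafIntegral_of_le {f : Polynomial ℝ} {M : ℝ}
    (hM : ∀ u, 0 ≤ u → f.eval u ≤ M) :
    ∃ H : ℝ × ℝ → ℝ, (∀ z : ℝ × ℝ, 0 ≤ z.1 → AnalyticAt ℝ H z) ∧
      (∀ z : ℝ × ℝ, 0 ≤ z.1 → fderiv ℝ H z (2 * (f.eval z.1 - z.2), 1) = 0) ∧
      H (0, f.eval 0) = 0 ∧ fderiv ℝ H (0, f.eval 0) (1, 0) = 1 := by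
  obtain ⟨k, hk, δ, hδ0, hδ⟩ := exists_transversal_ray hM
  have hcd : ∀ z : ℝ × ℝ, 0 ≤ z.1 → ContDiffAt ℝ ω (leafCoordinate f k δ) z := fun z hz => by
    obtain ⟨t, w, hw, h⟩ := exists_crossing hM hk hz
    refine contDiffAt_leafCoordinate_of_leafFlow (t := t) ?_
    rw [h]
    exact contDiffAt_leafCoordinate_ray hδ (by linarith)
  have hP := hcd (0, f.eval 0) le_rfl
  have hray : ∀ w, -δ < w → leafCoordinate f k δ (k * w, f.eval 0 + w) = w := fun w hw =>
    leafCoordinate_eq hδ (t := 0) hw (leafFlow_zero f _)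
  have hfd : ∀ z : ℝ × ℝ, 0 ≤ z.1 → fderiv ℝ (fun z => k * leafCoordinate f k δ z) z =
      k • fderiv ℝ (leafCoordinate f k δ) z := fun z hz =>
    fderiv_const_mul ((hcd z hz).differentiableAt (by simp)) k
  -- The factor `k` normalizes `H_u`: the ray has velocity `(k, 1)`, the coordinate has derivative
  -- `1` along it, and at `(0, f(0))` the leaf direction `(0, 1)` contributes nothing.
  refine ⟨fun z => k * leafCoordinate f k δ z, fun z hz =>
    (contDiffAt_const.mul (hcd z hz)).analyticAt, fun z hz => ?_, ?_, ?_⟩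
  · rw [hfd z hz, smul_apply, fderiv_leafCoordinate (hcd z hz), smul_zero]
  · have := hray 0 (by linarith)
    rw [mul_zero, add_zero] at this
    simp only [this, mul_zero]
  · rw [hfd _ le_rfl]
    have h1 := fderiv_leafCoordinate hP
    have h2 : HasDerivAt (fun w : ℝ => (k * w, f.eval 0 + w)) (k, 1) 0 := by
      simpa using ((hasDerivAt_id (0 : ℝ)).const_mul k).prodMk
        ((hasDerivAt_id (0 : ℝ)).const_add (f.eval 0))
    have h3 := HasFDerivAt.comp_hasDerivAt (l := leafCoordinate f k δ)
      (f := fun w : ℝ => (k * w, f.eval 0 + w)) (0 : ℝ)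
      (by simpa using (hP.differentiableAt (by simp)).hasFDerivAt) h2
    have h4 : HasDerivAt (leafCoordinate f k δ ∘ fun w : ℝ => (k * w, f.eval 0 + w)) 1 0 := by
      refine (hasDerivAt_id (0 : ℝ)).congr_of_eventuallyEq ?_
      filter_upwards [lt_mem_nhds (show -δ < 0 by linarith)] with w hw using hray w hw
    have h5 := h3.unique h4
    have e : ((k, 1) : ℝ × ℝ) = k • (1, 0) + (2 * (f.eval 0 - f.eval 0), 1) := by simp
    rw [e, map_add, h1, add_zero, map_smul] at h5
    exact h5

theorem exists_bound_above_or_below (f : Polynomial ℝ) :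
    (∃ M, ∀ u, 0 ≤ u → f.eval u ≤ M) ∨ ∃ M, ∀ u, 0 ≤ u → (-f).eval u ≤ M := by
  have key : ∀ g : Polynomial ℝ, (∃ C, ∀ᶠ u in Filter.atTop, g.eval u ≤ C) →
      ∃ M, ∀ u, 0 ≤ u → g.eval u ≤ M := by
    rintro g ⟨C, hC⟩
    obtain ⟨R, hR⟩ := Filter.eventually_atTop.1 hC
    obtain ⟨B, hB⟩ := (isCompact_Icc (a := (0 : ℝ)) (b := R)).bddAbove_image
      g.continuous.continuousOn
    refine ⟨max B C, fun u hu => ?_⟩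
    rcases le_total u R with h | h
    · exact (hB ⟨u, ⟨hu, h⟩, rfl⟩).trans (le_max_left _ _)
    · exact (hR u h).trans (le_max_right _ _)
  have hneg : ∀ g : Polynomial ℝ, g.leadingCoeff ≤ 0 → ∃ C, ∀ᶠ u in Filter.atTop, g.eval u ≤ C := by
    intro g hg
    rcases Nat.eq_zero_or_pos g.natDegree with h | h
    · rw [Polynomial.eq_C_of_natDegree_eq_zero h]
      exact ⟨g.coeff 0, by simp⟩
    · exact ⟨0, (g.tendsto_atBot_of_leadingCoeff_nonpos (Polynomial.natDegree_pos_iff_degree_pos.1 h)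
        hg).eventually_le_atBot 0⟩
  rcases le_total f.leadingCoeff 0 with h | h
  · exact Or.inl (key f (hneg f h))
  · exact Or.inr (key (-f) (hneg (-f) (by simpa using h)))

/-- The reflection `y ↦ -y` maps leaves for `f` to leaves for `-f`, reducing to the case bounded
above. -/
theorem exists_leafIntegral (f : Polynomial ℝ) :
    ∃ H : ℝ × ℝ → ℝ, (∀ z : ℝ × ℝ, 0 ≤ z.1 → AnalyticAt ℝ H z) ∧
      (∀ z : ℝ × ℝ, 0 ≤ z.1 → fderiv ℝ H z (2 * (f.eval z.1 - z.2), 1) = 0) ∧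
      H (0, f.eval 0) = 0 ∧ fderiv ℝ H (0, f.eval 0) (1, 0) = 1 := by
  rcases exists_bound_above_or_below f with ⟨M, hM⟩ | ⟨M, hM⟩
  · exact exists_leafIntegral_of_le hM
  obtain ⟨H, h1, h2, h3, h4⟩ := exists_leafIntegral_of_le hM
  let R : ℝ × ℝ →L[ℝ] ℝ × ℝ :=
    (ContinuousLinearMap.fst ℝ ℝ ℝ).prod (-ContinuousLinearMap.snd ℝ ℝ ℝ)
  have hR : ∀ z, R z = (z.1, -z.2) := fun _ => rfl
  have hfd : ∀ z : ℝ × ℝ, 0 ≤ z.1 → ∀ v, fderiv ℝ (H ∘ R) z v = fderiv ℝ H (R z) (R v) :=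
    fun z hz v => by
      rw [fderiv_comp z (h1 (R z) hz).differentiableAt R.differentiableAt, R.fderiv]
      rfl
  refine ⟨H ∘ R, fun z hz => (h1 (R z) hz).comp (R.analyticAt z), fun z hz => ?_, ?_, ?_⟩
  · have e : R (2 * (f.eval z.1 - z.2), 1) = -(2 * ((-f).eval (R z).1 - (R z).2), 1) := by
      simp only [hR, Polynomial.eval_neg, Prod.neg_mk]
      congr 1
      ring
    rw [hfd z hz, e, map_neg, h2 (R z) hz, neg_zero]
  · simpa [hR] using h3
  · rw [hfd _ le_rfl]
    simpa [hR] using h4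

/-! ### Pulling back to the Liénard field by `u = x²` -/

theorem exists_eval_sq_of_even {F : Polynomial ℝ} (hF : ∀ x : ℝ, F.eval (-x) = F.eval x) :
    ∃ f : Polynomial ℝ, ∀ x : ℝ, F.eval x = f.eval (x ^ 2) := by
  have hcomp : F.comp (Polynomial.C (-1) * Polynomial.X) = F :=
    Polynomial.funext fun x => by simp [hF]
  have hodd : ∀ n, ¬ 2 ∣ n → F.coeff n = 0 := fun n hn => by
    have h := congrArg (fun p => Polynomial.coeff p n) hcomp
    simp only [Polynomial.comp_C_mul_X_coeff] at h
    rw [(Nat.not_even_iff_odd.1 fun he => hn he.two_dvd).neg_one_pow] at h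
    linarith
  refine ⟨F.contract 2, fun x => ?_⟩
  have : Polynomial.expand ℝ 2 (F.contract 2) = F := by
    ext n
    rw [Polynomial.coeff_expand two_pos]
    split_ifs with h
    · rw [Polynomial.coeff_contract two_ne_zero, Nat.div_mul_cancel h]
    · exact (hodd n h).symm
  rw [← Polynomial.expand_eval, this]

section SquareSubstitution

variable {H : ℝ × ℝ → ℝ}

theorem hasFDerivAt_sq_prod (z : ℝ × ℝ) :
    HasFDerivAt (fun z : ℝ × ℝ => (z.1 ^ 2, z.2))
      (((2 * z.1) • ContinuousLinearMap.fst ℝ ℝ ℝ).prod (ContinuousLinearMap.snd ℝ ℝ ℝ)) z := by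
  have h1 : HasFDerivAt (fun z : ℝ × ℝ => z.1 ^ 2) ((2 * z.1) • ContinuousLinearMap.fst ℝ ℝ ℝ) z := by
    simpa using (hasFDerivAt_fst (𝕜 := ℝ) (p := z)).pow 2
  exact h1.prodMk hasFDerivAt_snd

theorem fderiv_comp_sq_prod {z : ℝ × ℝ} (h : DifferentiableAt ℝ H (z.1 ^ 2, z.2)) (v : ℝ × ℝ) :
    fderiv ℝ (fun z : ℝ × ℝ => H (z.1 ^ 2, z.2)) z v =
      fderiv ℝ H (z.1 ^ 2, z.2) (2 * z.1 * v.1, v.2) := by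
  have h1 := HasFDerivAt.comp z (g := H) (f := fun z : ℝ × ℝ => (z.1 ^ 2, z.2))
    h.hasFDerivAt (hasFDerivAt_sq_prod z)
  have h2 : HasFDerivAt (fun z : ℝ × ℝ => H (z.1 ^ 2, z.2)) _ z := h1
  rw [h2.fderiv]
  simp

theorem analyticAt_comp_sq_prod {z : ℝ × ℝ} (h : AnalyticAt ℝ H (z.1 ^ 2, z.2)) :
    AnalyticAt ℝ (fun z : ℝ × ℝ => H (z.1 ^ 2, z.2)) z :=
  AnalyticAt.comp (g := H) (f := fun z : ℝ × ℝ => (z.1 ^ 2, z.2)) h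
    ((analyticAt_fst.pow 2).prod analyticAt_snd)

theorem fderiv_comp_sq_prod_lienardField {F f : Polynomial ℝ}
    (hf : ∀ x : ℝ, F.eval x = f.eval (x ^ 2)) {z : ℝ × ℝ}
    (h : DifferentiableAt ℝ H (z.1 ^ 2, z.2))
    (h0 : fderiv ℝ H (z.1 ^ 2, z.2) (2 * (f.eval (z.1 ^ 2) - z.2), 1) = 0) :
    fderiv ℝ (fun z : ℝ × ℝ => H (z.1 ^ 2, z.2)) z (lienardField F z) = 0 := by
  rw [fderiv_comp_sq_prod h]
  have e : (2 * z.1 * (lienardField F z).1, (lienardField F z).2) =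
      (-z.1) • (2 * (f.eval (z.1 ^ 2) - z.2), (1 : ℝ)) := by
    simp only [lienardField, hf, Prod.smul_mk, smul_eq_mul]
    congr 1 <;> ring
  rw [e, map_smul, h0, smul_zero]

end SquareSubstitution

/-- For nonconstancy: if `J` were constant on an open set, the identity theorem would make it
constant on the plane, contradicting `H_u = 1` at `(0, f(0))`. -/
theorem isAnalyticFirstIntegralOn_univ {F f : Polynomial ℝ}
    (hf : ∀ x : ℝ, F.eval x = f.eval (x ^ 2)) {H : ℝ × ℝ → ℝ}
    (h1 : ∀ z : ℝ × ℝ, 0 ≤ z.1 → AnalyticAt ℝ H z)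
    (h2 : ∀ z : ℝ × ℝ, 0 ≤ z.1 → fderiv ℝ H z (2 * (f.eval z.1 - z.2), 1) = 0)
    (h3 : H (0, f.eval 0) = 0) (h4 : fderiv ℝ H (0, f.eval 0) (1, 0) = 1) :
    IsAnalyticFirstIntegralOn F Set.univ (fun z => H (z.1 ^ 2, z.2)) := by
  have han : AnalyticOnNhd ℝ (fun z : ℝ × ℝ => H (z.1 ^ 2, z.2)) Set.univ := fun z _ =>
    analyticAt_comp_sq_prod (h1 _ (sq_nonneg z.1))
  refine ⟨han, fun z _ => fderiv_comp_sq_prod_lienardField hf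
    (h1 _ (sq_nonneg z.1)).differentiableAt (h2 _ (sq_nonneg z.1)), fun V _ hV ⟨v, hv⟩ => ?_⟩
  by_contra! hcon
  have hconst : (fun z : ℝ × ℝ => H (z.1 ^ 2, z.2)) = fun _ => H (v.1 ^ 2, v.2) :=
    han.eq_of_eventuallyEq (fun _ _ => analyticAt_const) (z₀ := v) (by
      filter_upwards [hV.mem_nhds hv] with z hz using hcon z hz v hv)
  have hH : ∀ u, 0 ≤ u → H (u, f.eval 0) = 0 := fun u hu => by
    have e1 := congrFun hconst (√u, f.eval 0)
    have e2 := congrFun hconst (0, f.eval 0)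
    simp only [Real.sq_sqrt hu] at e1
    simp only [ne_eq, OfNat.ofNat_ne_zero, not_false_eq_true, zero_pow, h3] at e2
    rw [e1, ← e2]
  have hd : HasDerivAt (fun u : ℝ => H (u, f.eval 0)) 1 0 := by
    have := HasFDerivAt.comp_hasDerivAt (l := H) (f := fun u : ℝ => (u, f.eval 0)) (0 : ℝ)
      (h1 (0, f.eval 0) le_rfl).differentiableAt.hasFDerivAt
      ((hasDerivAt_id (0 : ℝ)).prodMk (hasDerivAt_const (0 : ℝ) (f.eval 0)))
    rwa [h4] at this
  -- Constancy of `J` controls `H` only on `u ≥ 0`, hence the comparison of one-sided derivatives.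
  have hd0 : HasDerivWithinAt (fun u : ℝ => H (u, f.eval 0)) 0 (Set.Ici 0) 0 :=
    (hasDerivWithinAt_const (0 : ℝ) (Set.Ici 0) (0 : ℝ)).congr (fun u hu => hH u hu) (hH 0 le_rfl)
  exact one_ne_zero ((uniqueDiffWithinAt_Ici (0 : ℝ)).eq_deriv _ hd.hasDerivWithinAt hd0)

/-! ### Closed orbits, separating polynomials, kernel and cokernel -/

theorem isCompact_of_isClosedOrbit {F : Polynomial ℝ} {S : Set (ℝ × ℝ)} (h : IsClosedOrbit F S) :
    IsCompact S := by
  obtain ⟨c, hc, ⟨T, hT, hper⟩, -, rfl⟩ := h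
  exact hper.compact_of_continuous hT.ne'
    (continuous_iff_continuousAt.2 fun t => (hc t).continuousAt)

theorem closedOrbit_eq_of_mem {F : Polynomial ℝ} {S S' : Set (ℝ × ℝ)} (h : IsClosedOrbit F S)
    (h' : IsClosedOrbit F S') {z : ℝ × ℝ} (hz : z ∈ S) (hz' : z ∈ S') : S = S' := by
  obtain ⟨c, hc, -, -, rfl⟩ := h
  obtain ⟨d, hd, -, -, rfl⟩ := h'
  obtain ⟨s, rfl⟩ := hz
  obtain ⟨t, ht⟩ := hz'
  have e := integralCurve_unique (contDiff_lienardField F 1) hd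
    (fun r => (hc (s - t + r)).comp_const_add (s - t) r) (t₀ := t) (by simpa using ht)
  ext w
  constructor
  · rintro ⟨r, rfl⟩
    exact ⟨r - (s - t), by rw [e]; simp⟩
  · rintro ⟨r, rfl⟩
    exact ⟨s - t + r, by rw [e]⟩

/-- The index of the set containing a point is continuous on the compact disjoint union. By
Stone–Weierstrass some polynomial is within `1/2` of it, and distinct integers are at least `1`
apart. -/
theorem exists_polynomial_separatesSets {m : ℕ} {γ : Fin m → Set (ℝ × ℝ)}
    (hγ : ∀ i, IsCompact (γ i)) (hdisj : ∀ i j, i ≠ j → Disjoint (γ i) (γ j)) :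
    ∃ P : MvPolynomial (Fin 2) ℝ,
      SeparatesSets (fun z : ℝ × ℝ => MvPolynomial.eval ![z.1, z.2] P) γ := by
  let K : Set (ℝ × ℝ) := ⋃ i, γ i
  have hK : CompactSpace K := isCompact_iff_compactSpace.1 (isCompact_iUnion hγ)
  choose idx hidx using fun z : K => Set.mem_iUnion.1 z.2
  have hidx_eq : ∀ (z : K) i, z.1 ∈ γ i → idx z = i := fun z i hz => by
    by_contra hne
    exact Set.disjoint_left.1 (hdisj _ _ hne) (hidx z) hz
  have hcont : Continuous idx := continuous_iff_isClosed.2 fun s _ => by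
    have : idx ⁻¹' s = ⋃ i ∈ s, Subtype.val ⁻¹' γ i := by
      ext z
      simp only [Set.mem_preimage, Set.mem_iUnion, exists_prop]
      exact ⟨fun h => ⟨_, h, hidx z⟩, fun ⟨i, hi, hz⟩ => (hidx_eq z i hz) ▸ hi⟩
    rw [this]
    exact s.toFinite.isClosed_biUnion fun i _ => (hγ i).isClosed.preimage continuous_subtype_val
  let coord : Fin 2 → C(K, ℝ) := ![⟨fun z => z.1.1, by fun_prop⟩, ⟨fun z => z.1.2, by fun_prop⟩]
  let A : MvPolynomial (Fin 2) ℝ →ₐ[ℝ] C(K, ℝ) := MvPolynomial.aeval coord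
  have hA : ∀ P (z : K), A P z = MvPolynomial.eval ![z.1.1, z.1.2] P := fun P z => by
    have e : (ContinuousMap.evalAlgHom ℝ ℝ z).comp A = MvPolynomial.aeval ![z.1.1, z.1.2] := by
      refine MvPolynomial.algHom_ext fun i => ?_
      fin_cases i <;> simp [A, coord]
    exact DFunLike.congr_fun e P
  have hsep : A.range.SeparatesPoints := by
    intro x y hxy
    have : x.1.1 ≠ y.1.1 ∨ x.1.2 ≠ y.1.2 := by
      by_contra! h
      exact hxy (Subtype.ext (Prod.ext h.1 h.2))
    rcases this with h | h
    · exact ⟨_, ⟨A (MvPolynomial.X 0), ⟨_, rfl⟩, rfl⟩, by simpa [hA] using h⟩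
    · exact ⟨_, ⟨A (MvPolynomial.X 1), ⟨_, rfl⟩, rfl⟩, by simpa [hA] using h⟩
  obtain ⟨⟨g, P, hP⟩, hg⟩ :=
    ContinuousMap.exists_mem_subalgebra_near_continuous_of_separatesPoints A.range hsep
      (fun z => ((idx z : ℕ) : ℝ)) (by fun_prop) (1 / 2) (by norm_num)
  have hnear : ∀ i, ∀ z ∈ γ i, |MvPolynomial.eval ![z.1, z.2] P - (i : ℕ)| < 1 / 2 := fun i z hz => by
    have hzK : z ∈ K := Set.mem_iUnion.2 ⟨i, hz⟩
    have h := hg ⟨z, hzK⟩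
    rw [hidx_eq ⟨z, hzK⟩ i hz] at h
    have e : g ⟨z, hzK⟩ = MvPolynomial.eval ![z.1, z.2] P := by
      rw [← hA P ⟨z, hzK⟩]
      exact congrArg (fun a : C(K, ℝ) => a ⟨z, hzK⟩) hP.symm
    rw [← e]
    exact h
  refine ⟨P, fun i j hij => Set.disjoint_left.2 ?_⟩
  rintro _ ⟨z, hz, rfl⟩ ⟨w, hw, hzw⟩
  have h1 := hnear i z hz
  have h2 := hnear j w hw
  simp only at hzw
  rw [hzw] at h2
  have h3 : |((i : ℕ) : ℝ) - (j : ℕ)| < 1 := by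
    rw [abs_lt] at *
    constructor <;> linarith
  have h4 : |((i : ℕ) : ℤ) - (j : ℕ)| < 1 := by exact_mod_cast h3
  have h5 := Int.abs_lt_one_iff.1 h4
  exact hij (Fin.ext (by omega))

theorem coeff_eq_zero_of_sum_pow {m : ℕ} {g : Fin m → ℝ} {x : Fin m → ℝ}
    (hx : Function.Injective x) (h : ∀ i, ∑ k, g k * x i ^ (k : ℕ) = 0) : ∀ k, g k = 0 := by
  have hdet : (Matrix.vandermonde x).det ≠ 0 := Matrix.det_vandermonde_ne_zero_iff.2 hx
  have : (Matrix.vandermonde x).mulVec g = 0 := by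
    funext i
    simpa [Matrix.mulVec, dotProduct, mul_comm] using h i
  exact fun k => congrFun (Matrix.eq_zero_of_mulVec_eq_zero hdet this) k

theorem linearIndependent_pow_cokernel {F : Polynomial ℝ} {n : WithTop ℕ∞} (hn : n = ∞ ∨ n = ω)
    {m : ℕ} {γ : Fin m → Set (ℝ × ℝ)} (hγ : ∀ i, IsClosedOrbit F (γ i)) {f : planeFunctions n}
    (hf : SeparatesSets f.1 γ) :
    LinearIndependent ℝ
      (fun k : Fin m => (Submodule.Quotient.mk (f ^ (k : ℕ)) : lienardCokernel F n hn)) := by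
  rw [Fintype.linearIndependent_iff]
  intro g hg
  have hmk : (Submodule.Quotient.mk (∑ k, g k • f ^ (k : ℕ)) : lienardCokernel F n hn) = 0 := by
    rw [← hg, ← Submodule.mkQ_apply, map_sum]
    rfl
  rw [Submodule.Quotient.mk_eq_zero] at hmk
  obtain ⟨h, hh⟩ := hmk
  have hval : ∀ z, fderiv ℝ h.1 z (lienardField F z) = ∑ k, g k * f.1 z ^ (k : ℕ) := fun z => by
    have e := congrArg (fun a : planeFunctions n => a.1 z) hh
    simpa using! e
  have hn0 : n ≠ 0 := by rcases hn with rfl | rfl <;> simp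
  have hd : Differentiable ℝ h.1 := ContDiff.differentiable h.2 hn0
  have hroot : ∀ i, ∃ z ∈ γ i, ∑ k, g k * f.1 z ^ (k : ℕ) = 0 := fun i => by
    obtain ⟨c, hc, ⟨T, hT, hper⟩, -, hS⟩ := hγ i
    have hder : ∀ t, HasDerivAt (h.1 ∘ c) (fderiv ℝ h.1 (c t) (lienardField F (c t))) t :=
      fun t => (hd (c t)).hasFDerivAt.comp_hasDerivAt t (hc t)
    -- Rolle's theorem over one period of the orbit.
    obtain ⟨t, -, ht⟩ := exists_hasDerivAt_eq_zero hT
      (fun t _ => (hder t).continuousAt.continuousWithinAt)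
      (by simpa using congrArg h.1 (hper 0).symm) (fun t _ => hder t)
    exact ⟨c t, hS ▸ ⟨t, rfl⟩, by rw [← hval, ht]⟩
  choose z hz hz0 using hroot
  refine coeff_eq_zero_of_sum_pow (x := fun i => f.1 (z i)) (fun i j hij => ?_) hz0
  by_contra hne
  exact Set.disjoint_left.1 (hf i j hne) ⟨z i, hz i, rfl⟩ ⟨z j, hz j, hij.symm⟩

theorem exists_polynomial_planeFunction (n : WithTop ℕ∞) (P : MvPolynomial (Fin 2) ℝ) :
    ∃ f : planeFunctions n, ∀ z, f.1 z = MvPolynomial.eval ![z.1, z.2] P := by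
  refine ⟨⟨fun z => MvPolynomial.eval ![z.1, z.2] P, ?_⟩, fun _ => rfl⟩
  change ContDiff ℝ n fun z : ℝ × ℝ => MvPolynomial.eval ![z.1, z.2] P
  induction P using MvPolynomial.induction_on with
  | C a => simpa using contDiff_const
  | add p q hp hq => simpa using hp.add hq
  | mul_X p i hp =>
    simp only [map_mul, MvPolynomial.eval_X]
    refine hp.mul ?_
    fin_cases i
    · simpa using contDiff_fst
    · simpa using contDiff_snd

theorem not_finiteDimensional_of_forall_linearIndependent {V : Type*} [AddCommGroup V] [Module ℝ V]
    (h : ∀ m : ℕ, ∃ v : Fin m → V, LinearIndependent ℝ v) : ¬ FiniteDimensional ℝ V := fun _ => by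
  obtain ⟨v, hv⟩ := h (Module.finrank ℝ V + 1)
  have := hv.fintype_card_le_finrank
  simp at this

/-- Powers of `J` lie in the kernel. The range of `J` is a nondegenerate interval, so it has enough
points for a Vandermonde argument on any number of powers. -/
theorem not_finiteDimensional_ker {F : Polynomial ℝ} {J : ℝ × ℝ → ℝ}
    (hJ : IsAnalyticFirstIntegralOn F Set.univ J) (n : WithTop ℕ∞) (hn : n = ∞ ∨ n = ω) :
    ¬ FiniteDimensional ℝ (LinearMap.ker (lienardOperator F n hn)) := by
  obtain ⟨hJ1, hJ2, hJ3⟩ := hJ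
  have hJd : ContDiff ℝ n J := by
    have : ContDiff ℝ ω J := contDiffOn_univ.1 hJ1.contDiffOn_of_completeSpace
    exact this.of_le le_top
  have hJdiff : Differentiable ℝ J := fun z => (hJ1 z trivial).differentiableAt
  obtain ⟨z, -, w, -, hne⟩ := hJ3 Set.univ subset_rfl isOpen_univ ⟨0, trivial⟩
  have hinf : (Set.range J).Infinite := by
    have hpre : (Set.range J).OrdConnected :=
      (isPreconnected_range hJd.continuous).ordConnected
    have hsub := hpre.uIcc_subset ⟨z, rfl⟩ ⟨w, rfl⟩
    rcases lt_or_gt_of_ne hne with h | h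
    · exact (Set.Icc_infinite h).mono (Set.Icc_subset_uIcc.trans hsub)
    · exact (Set.Icc_infinite h).mono (Set.Icc_subset_uIcc'.trans hsub)
  refine not_finiteDimensional_of_forall_linearIndependent fun m => ?_
  let j : planeFunctions n := ⟨J, hJd⟩
  have hker : ∀ k : ℕ, j ^ k ∈ LinearMap.ker (lienardOperator F n hn) := fun k => by
    rw [LinearMap.mem_ker]
    ext z
    change fderiv ℝ (j ^ k).1 z (lienardField F z) = 0
    have e : (j ^ k).1 = fun z => J z ^ k := by ext z; simp [j]
    rw [e, ((hJdiff z).hasFDerivAt.pow k).fderiv]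
    simp [hJ2 z trivial]
  refine ⟨fun k => ⟨j ^ (k : ℕ), hker k⟩, ?_⟩
  refine Fintype.linearIndependent_iff.2 fun g hg => ?_
  obtain ⟨s, hs, hcard⟩ := hinf.exists_subset_card_eq m
  let e := s.equivFinOfCardEq hcard
  refine coeff_eq_zero_of_sum_pow (x := fun i => ((e.symm i : s) : ℝ))
    (Subtype.val_injective.comp e.symm.injective) fun i => ?_
  obtain ⟨z, hz⟩ := hs (e.symm i).2
  have := congrArg (fun a : LinearMap.ker (lienardOperator F n hn) => a.1.1 z) hg
  rw [← hz]
  simpa [j] using! this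

/-! ### Rotation about the equilibrium and the reversing symmetry -/

theorem exists_zero_of_rotation {a b a' b' : ℝ → ℝ} (ha : ∀ t, HasDerivAt a (a' t) t)
    (hb : ∀ t, HasDerivAt b (b' t) t)
    (h : ∀ t, (a t ^ 2 + b t ^ 2) / 2 ≤ a' t * b t - a t * b' t) (T : ℝ) :
    ∃ t ∈ Set.Icc T (T + 7), b t = 0 := by
  by_contra! hne
  -- If `b` has no zero, the angle `arctan(a/b)` grows at rate at least `1/2`, gaining at least `7/2
  -- > π` in time `7`, which exceeds the range of `arctan`.
  have hd : ∀ t ∈ Set.Icc T (T + 7), HasDerivAt (fun t => Real.arctan (a t / b t))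
      (1 / (1 + (a t / b t) ^ 2) * ((a' t * b t - a t * b' t) / b t ^ 2)) t := fun t ht =>
    ((ha t).div (hb t) (hne t ht)).arctan
  have hge : ∀ t ∈ Set.Icc T (T + 7),
      1 / 2 ≤ 1 / (1 + (a t / b t) ^ 2) * ((a' t * b t - a t * b' t) / b t ^ 2) := fun t ht => by
    have hb2 : 0 < b t ^ 2 := by have := hne t ht; positivity
    have e : 1 / (1 + (a t / b t) ^ 2) * ((a' t * b t - a t * b' t) / b t ^ 2) =
        (a' t * b t - a t * b' t) / (a t ^ 2 + b t ^ 2) := by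
      have := hne t ht
      have h3 : b t ^ 2 + a t ^ 2 ≠ 0 := by positivity
      have h4 : a t ^ 2 + b t ^ 2 ≠ 0 := by positivity
      field_simp
      ring
    rw [e, le_div_iff₀ (by positivity)]
    linarith [h t]
  have hmvt := Convex.mul_sub_le_image_sub_of_le_deriv (convex_Icc T (T + 7))
    (fun t ht => (hd t ht).continuousAt.continuousWithinAt)
    (fun t ht => (hd t (interior_subset ht)).differentiableAt.differentiableWithinAt)
    (C := 1 / 2) (fun t ht => by
      rw [(hd t (interior_subset ht)).deriv]; exact hge t (interior_subset ht))
    T (Set.left_mem_Icc.2 (by linarith)) (T + 7) (Set.right_mem_Icc.2 (by linarith)) (by linarith)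
  have h1 := Real.arctan_lt_pi_div_two (a (T + 7) / b (T + 7))
  have h2 := Real.neg_pi_div_two_lt_arctan (a T / b T)
  have h3 := Real.pi_lt_d2
  linarith

section LienardSolutions

variable {F : Polynomial ℝ} {c : ℝ → ℝ × ℝ} (hc : ∀ t, HasDerivAt c (lienardField F (c t)) t)
include hc

theorem hasDerivAt_solution_fst (t : ℝ) :
    HasDerivAt (fun t => (c t).1) ((c t).2 - F.eval (c t).1) t := (hc t).fst

theorem hasDerivAt_solution_snd (t : ℝ) : HasDerivAt (fun t => (c t).2) (-(c t).1) t := (hc t).snd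

/-- For even `F` the map `(x, y, t) ↦ (-x, y, 2T - t)` preserves solutions, and the reflected curve
agrees with `c` at time `T`. -/
theorem solution_reflect (hF : ∀ x : ℝ, F.eval (-x) = F.eval x) {T : ℝ} (hT : (c T).1 = 0) (s : ℝ) :
    c (2 * T - s) = (-(c s).1, (c s).2) := by
  have hd : ∀ s, HasDerivAt (fun s => (-(c (2 * T - s)).1, (c (2 * T - s)).2))
      (lienardField F (-(c (2 * T - s)).1, (c (2 * T - s)).2)) s := fun s => by
    have h1 := ((hasDerivAt_solution_fst hc (2 * T - s)).comp_const_sub (2 * T) s).neg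
    have h2 := (hasDerivAt_solution_snd hc (2 * T - s)).comp_const_sub (2 * T) s
    have h3 := h1.prodMk h2
    simp only [neg_neg] at h3
    simpa [lienardField, hF] using h3
  have e := integralCurve_unique (contDiff_lienardField F 1) hc hd (t₀ := T) (by
    have : 2 * T - T = T := by ring
    rw [this]
    exact Prod.ext (by simp [hT]) rfl)
  have := congrFun e (2 * T - s)
  simpa using! this

/-- Two such reflections compose to a time translation. -/
theorem solution_periodic (hF : ∀ x : ℝ, F.eval (-x) = F.eval x) {T₁ T₂ : ℝ} (h₁ : (c T₁).1 = 0)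
    (h₂ : (c T₂).1 = 0) : Function.Periodic c (2 * (T₂ - T₁)) := fun t => by
  have e : t + 2 * (T₂ - T₁) = 2 * T₂ - (2 * T₁ - t) := by ring
  rw [e, solution_reflect hc hF h₂, solution_reflect hc hF h₁]
  simp

variable {r : ℝ} (hr : r ≤ 1 / 16) (hFr : ∀ x, |x| ≤ r → |F.eval x - F.eval 0| ≤ |x| / 16)
  (hcr : ∀ t, |(c t).1| ≤ r ∧ |(c t).2 - F.eval 0| ≤ r)
include hr hFr hcr

omit hr in
theorem exists_solution_fst_eq_zero (T : ℝ) : ∃ t ∈ Set.Icc T (T + 7), (c t).1 = 0 := by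
  refine exists_zero_of_rotation (a := fun t => -((c t).2 - F.eval 0))
    (fun t => ((hasDerivAt_solution_snd hc t).sub_const _).neg) (hasDerivAt_solution_fst hc)
    (fun t => ?_) T
  obtain ⟨h1, -⟩ := hcr t
  have h3 := hFr _ h1
  set x := (c t).1
  set v := (c t).2 - F.eval 0 with hv
  set g := F.eval x - F.eval 0 with hg
  have e : (c t).2 - F.eval x = v - g := by rw [hv, hg]; ring
  rw [e]
  have h4 : v * g ≤ |v| * (|x| / 16) := by
    refine (le_abs_self _).trans ?_
    rw [abs_mul]
    exact mul_le_mul_of_nonneg_left h3 (abs_nonneg _)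
  nlinarith [sq_abs x, sq_abs v, sq_nonneg (|x| - |v|)]

/-- The pair `(x, q)` with `q = y - F(0) + x²` also rotates: `x'q - xq'` equals `x² + q²` plus
corrections that the smallness of `r` absorbs. A zero of `q` is a point of the parabola. -/
theorem exists_solution_mem_parabola :
    ∃ t, (c t).2 = F.eval 0 - (c t).1 ^ 2 := by
  suffices h : ∃ t ∈ Set.Icc (0 : ℝ) (0 + 7), (c t).2 - F.eval 0 + (c t).1 ^ 2 = 0 by
    obtain ⟨t, -, ht⟩ := h
    exact ⟨t, by linarith⟩
  refine exists_zero_of_rotation (a := fun t => (c t).1)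
    (b := fun t => (c t).2 - F.eval 0 + (c t).1 ^ 2) (hasDerivAt_solution_fst hc)
    (fun t => ((hasDerivAt_solution_snd hc t).sub_const _).add
      ((hasDerivAt_solution_fst hc t).pow 2)) (fun t => ?_) 0
  obtain ⟨h1, h2⟩ := hcr t
  have h3 := hFr _ h1
  simp only [Nat.cast_ofNat, Nat.add_one_sub_one, pow_one]
  set x := (c t).1
  set v := (c t).2 - F.eval 0 with hv
  set g := F.eval x - F.eval 0 with hg
  have e : (c t).2 - F.eval x = v - g := by rw [hv, hg]; ring
  rw [e]
  set q := v + x ^ 2 with hq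
  have e2 : (v - g) * q - x * (-x + 2 * x * (v - g)) =
      q ^ 2 + x ^ 2 - (x ^ 2 * q + g * q) - 2 * x ^ 2 * (v - g) := by rw [hq]; ring
  rw [e2]
  have hx : |x| ≤ 1 / 16 := h1.trans hr
  have h4 : v - g ≤ 1 / 8 := by
    have := abs_le.1 h2
    have := abs_le.1 h3
    linarith
  have h5 : x ^ 2 * q ≤ |x| * |q| / 16 := by
    refine (le_abs_self _).trans ?_
    rw [abs_mul, abs_pow]
    nlinarith [mul_nonneg (abs_nonneg x) (abs_nonneg q)]
  have h6 : g * q ≤ |x| * |q| / 16 := by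
    refine (le_abs_self _).trans ?_
    rw [abs_mul]
    nlinarith [mul_le_mul_of_nonneg_right h3 (abs_nonneg q)]
  have h7 : 2 * x ^ 2 * (v - g) ≤ 2 * x ^ 2 * (1 / 8) :=
    mul_le_mul_of_nonneg_left h4 (by positivity)
  nlinarith [sq_abs x, sq_abs q, sq_nonneg (|x| - |q|)]

end LienardSolutions

/-! ### Local estimates and trapping near the equilibrium -/

theorem exists_radius_abs_eval_sub_le {F f : Polynomial ℝ}
    (hf : ∀ x : ℝ, F.eval x = f.eval (x ^ 2)) :
    ∃ r > 0, ∀ x, |x| ≤ r → |F.eval x - F.eval 0| ≤ |x| / 16 := by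
  have hF0 : F.eval 0 = f.eval 0 := by simpa using hf 0
  have hdx : ∀ x, F.eval x - F.eval 0 = x * (x * f.divX.eval (x ^ 2)) := fun x => by
    have := congrArg (Polynomial.eval (x ^ 2)) f.divX_mul_X_add
    simp only [Polynomial.eval_add, Polynomial.eval_mul, Polynomial.eval_X, Polynomial.eval_C,
      Polynomial.coeff_zero_eq_eval_zero] at this
    rw [hF0, hf x, ← this]
    ring
  have hcont : Continuous fun x : ℝ => x * f.divX.eval (x ^ 2) :=
    continuous_id.mul (f.divX.continuous.comp (continuous_pow 2))
  have hev : ∀ᶠ x in 𝓝 (0 : ℝ), |x * f.divX.eval (x ^ 2)| < 1 / 16 := by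
    have := hcont.abs.tendsto 0
    simp only [zero_mul, abs_zero] at this
    exact this.eventually (gt_mem_nhds (by norm_num))
  obtain ⟨r, hr, hball⟩ := Metric.eventually_nhds_iff_ball.1 hev
  refine ⟨r / 2, by positivity, fun x hx => ?_⟩
  have h := hball x (by rw [mem_ball_zero_iff, Real.norm_eq_abs]; linarith)
  rw [hdx, abs_mul]
  nlinarith [abs_nonneg x]

/-- Near the point `H_u ≥ 1/2`, while the leaf equation gives `H_y = 2(y - f(u)) H_u`. Integrating
first along `u = 0` from `y = f(0)`, then in `u`, yields the two squares. -/
theorem exists_radius_leafIntegral_ge {f : Polynomial ℝ} {H : ℝ × ℝ → ℝ}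
    (h1 : ∀ z : ℝ × ℝ, 0 ≤ z.1 → AnalyticAt ℝ H z)
    (h2 : ∀ z : ℝ × ℝ, 0 ≤ z.1 → fderiv ℝ H z (2 * (f.eval z.1 - z.2), 1) = 0)
    (h3 : H (0, f.eval 0) = 0) (h4 : fderiv ℝ H (0, f.eval 0) (1, 0) = 1) :
    ∃ r > 0, ∀ x y : ℝ, |x| ≤ r → |y - f.eval 0| ≤ r →
      (x ^ 2 + (y - f.eval 0) ^ 2) / 2 ≤ H (x ^ 2, y) := by
  have hcont : ContinuousAt (fun z => fderiv ℝ H z (1, 0)) (0, f.eval 0) :=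
    ((h1 _ le_rfl).fderiv.continuousAt).clm_apply continuousAt_const
  have hev : ∀ᶠ z in 𝓝 ((0 : ℝ), f.eval 0), 1 / 2 < fderiv ℝ H z (1, 0) :=
    hcont.eventually (lt_mem_nhds (by simp only [h4]; norm_num))
  obtain ⟨ρ, hρ, hball⟩ := Metric.eventually_nhds_iff_ball.1 hev
  have hHu : ∀ u y, 0 ≤ u → u < ρ → |y - f.eval 0| < ρ → 1 / 2 ≤ fderiv ℝ H (u, y) (1, 0) :=
    fun u y hu0 hu hy => (hball (u, y) (by
      rw [Metric.mem_ball, Prod.dist_eq, max_lt_iff, Real.dist_eq, Real.dist_eq, sub_zero,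
        abs_of_nonneg hu0]
      exact ⟨hu, hy⟩)).le
  have hHy : ∀ u y, 0 ≤ u → fderiv ℝ H (u, y) (0, 1) =
      2 * (y - f.eval u) * fderiv ℝ H (u, y) (1, 0) := fun u y hu => by
    have h := h2 (u, y) hu
    have e : ((2 * (f.eval u - y), 1) : ℝ × ℝ) = (2 * (f.eval u - y)) • (1, 0) + (0, 1) := by simp
    dsimp only at h
    rw [e, map_add, map_smul, smul_eq_mul] at h
    linarith
  refine ⟨min (ρ / 2) 1, by positivity, fun x y hx hy => ?_⟩
  have hy' : |y - f.eval 0| < ρ := by linarith [hy.trans (min_le_left _ _)]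
  have hx1 : |x| ≤ 1 := hx.trans (min_le_right _ _)
  have hx2 : x ^ 2 < ρ := by
    have := hx.trans (min_le_left _ _)
    nlinarith [sq_abs x, abs_nonneg x]
  set v := y - f.eval 0 with hv
  have hstep1 : v ^ 2 / 2 ≤ H (0, y) := by
    have hd : ∀ s : ℝ, HasDerivAt (fun s => H (0, f.eval 0 + s * v) - s ^ 2 * (v ^ 2 / 2))
        (fderiv ℝ H (0, f.eval 0 + s * v) (0, v) - s * v ^ 2) s := fun s => by
      have e1 : HasDerivAt (fun s : ℝ => ((0 : ℝ), f.eval 0 + s * v)) (0, v) s := by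
        simpa using (hasDerivAt_const s (0 : ℝ)).prodMk
          (((hasDerivAt_id s).mul_const v).const_add (f.eval 0))
      have e2 := HasFDerivAt.comp_hasDerivAt (l := H) s
        (h1 (0, f.eval 0 + s * v) le_rfl).differentiableAt.hasFDerivAt e1
      have e3 : HasDerivAt (fun s : ℝ => s ^ 2 * (v ^ 2 / 2)) (s * v ^ 2) s := by
        convert! (hasDerivAt_pow 2 s).mul_const (v ^ 2 / 2) using 1
        push_cast
        ring
      exact e2.sub e3
    have hmono : MonotoneOn (fun s => H (0, f.eval 0 + s * v) - s ^ 2 * (v ^ 2 / 2))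
        (Set.Icc 0 1) := by
      refine monotoneOn_of_deriv_nonneg (convex_Icc 0 1)
        (fun s _ => (hd s).continuousAt.continuousWithinAt)
        (fun s _ => (hd s).differentiableAt.differentiableWithinAt) fun s hs => ?_
      obtain ⟨hs0, hs1⟩ : s ∈ Set.Icc (0 : ℝ) 1 := interior_subset hs
      have hsv : |f.eval 0 + s * v - f.eval 0| < ρ := by
        rw [add_sub_cancel_left, abs_mul, abs_of_nonneg hs0]
        exact (mul_le_of_le_one_left (abs_nonneg v) hs1).trans_lt hy'
      have hu := hHu 0 _ le_rfl hρ hsv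
      have e : ((0, v) : ℝ × ℝ) = v • (0, 1) := by simp
      rw [(hd s).deriv, e, map_smul, hHy 0 _ le_rfl, smul_eq_mul, add_sub_cancel_left]
      have : 0 ≤ s * v ^ 2 := by positivity
      nlinarith
    have := hmono (Set.left_mem_Icc.2 zero_le_one) (Set.right_mem_Icc.2 zero_le_one) zero_le_one
    simp only [zero_mul, add_zero, h3, one_mul, ne_eq, OfNat.ofNat_ne_zero, not_false_eq_true,
      zero_pow, sub_zero, one_pow] at this
    have e : f.eval 0 + v = y := by rw [hv]; ring
    rw [e] at this
    linarith
  have hstep2 : x ^ 2 / 2 ≤ H (x ^ 2, y) - H (0, y) := by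
    have hd : ∀ u, 0 ≤ u → HasDerivAt (fun u => H (u, y)) (fderiv ℝ H (u, y) (1, 0)) u :=
      fun u hu => HasFDerivAt.comp_hasDerivAt (l := H) (f := fun u : ℝ => (u, y)) u
        (h1 (u, y) hu).differentiableAt.hasFDerivAt
        ((hasDerivAt_id u).prodMk (hasDerivAt_const u y))
    have := Convex.mul_sub_le_image_sub_of_le_deriv (convex_Icc (0 : ℝ) (x ^ 2))
      (fun u hu => (hd u hu.1).continuousAt.continuousWithinAt)
      (fun u hu => (hd u (interior_subset hu : u ∈ Set.Icc 0 (x ^ 2)).1).differentiableAt.differentiableWithinAt)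
      (C := 1 / 2) (fun u hu => by
        have hu' : u ∈ Set.Icc 0 (x ^ 2) := interior_subset hu
        rw [(hd u hu'.1).deriv]
        exact hHu u y hu'.1 (hu'.2.trans_lt hx2) hy')
      0 (Set.left_mem_Icc.2 (sq_nonneg x)) (x ^ 2) (Set.right_mem_Icc.2 (sq_nonneg x)) (sq_nonneg x)
    linarith
  linarith

/-- Solutions of a smooth planar field cannot leave a ball through the boundary on which a conserved
quantity exceeds its value at the initial point, and hence exist for all time. -/
theorem exists_solution_mem_ball {v : ℝ × ℝ → ℝ × ℝ} (hv : ContDiff ℝ 1 v) {J : ℝ × ℝ → ℝ}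
    (hJ : Differentiable ℝ J) (hJv : ∀ z, fderiv ℝ J z (v z) = 0) {p : ℝ × ℝ} {r ε : ℝ}
    (hr : 0 < r) (hsphere : ∀ z, dist z p = r → ε ≤ J z) {z : ℝ × ℝ} (hz : dist z p < r)
    (hzε : J z < ε) :
    ∃ c : ℝ → ℝ × ℝ, c 0 = z ∧ ∀ t, HasDerivAt c (v (c t)) t ∧ dist (c t) p < r ∧ J (c t) = J z := by
  -- Cutting off makes the field bounded, so curves are global. The cutoff only rescales speed, so
  -- `J` remains conserved, and it is `1` on the ball where the curve stays trapped.
  let χ : ContDiffBump p := ⟨r, r + 1, hr, by linarith⟩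
  have hw : ContDiff ℝ 1 fun z => χ z • v z := χ.contDiff.smul hv
  obtain ⟨M, hM⟩ := HasCompactSupport.exists_bound_of_continuous (f := fun z => χ z • v z)
    χ.hasCompactSupport.smul_right hw.continuous
  obtain ⟨c, hc0, hc⟩ := exists_integralCurve_of_bounded hw hM z
  have hJc : ∀ t, J (c t) = J z := fun t => by
    have hd : ∀ t, HasDerivAt (J ∘ c) 0 t := fun t => by
      have := (hJ (c t)).hasFDerivAt.comp_hasDerivAt t (hc t)
      rwa [map_smul, hJv, smul_zero] at this
    have := is_const_of_deriv_eq_zero (fun t => (hd t).differentiableAt) (fun t => (hd t).deriv) t 0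
    simpa [hc0] using this
  have hball : ∀ t, dist (c t) p < r := fun t => by
    by_contra! hge
    have hcont : Continuous fun t => dist (c t) p :=
      (continuous_iff_continuousAt.2 fun t => (hc t).continuousAt).dist continuous_const
    obtain ⟨s, hs⟩ := mem_range_of_exists_le_of_exists_ge hcont ⟨0, by rw [hc0]; exact hz.le⟩ ⟨t, hge⟩
    exact absurd (hsphere _ hs) (by rw [hJc]; exact hzε.not_ge)
  refine ⟨c, hc0, fun t => ⟨?_, hball t, hJc t⟩⟩
  have h1 : χ (c t) = 1 := χ.one_of_mem_closedBall (Metric.mem_closedBall.2 (hball t).le)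
  have := hc t
  rwa [h1, one_smul] at this

theorem exists_analytic_localInverse {m : ℝ → ℝ} (hm : AnalyticAt ℝ m 0) (hm0 : m 0 = 0)
    (hm1 : HasDerivAt m 1 0) :
    ∃ g : ℝ → ℝ, ∃ ε > 0, g 0 = 0 ∧ (∀ s, |s| < ε → AnalyticAt ℝ g s) ∧
      (∀ s, |s| < ε → m (g s) = s) ∧ ∀ s, |s| < ε → g (m s) = s := by
  have hcd : ContDiffAt ℝ ω m 0 := hm.contDiffAt
  have hω : (ω : WithTop ℕ∞) ≠ 0 := by simp
  have hf' : HasFDerivAt m ((ContinuousLinearEquiv.refl ℝ ℝ : ℝ ≃L[ℝ] ℝ) : ℝ →L[ℝ] ℝ) 0 := by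
    have : ((ContinuousLinearEquiv.refl ℝ ℝ : ℝ ≃L[ℝ] ℝ) : ℝ →L[ℝ] ℝ) =
        ContinuousLinearMap.toSpanSingleton ℝ 1 := by ext; simp
    rw [this]
    exact hm1.hasFDerivAt
  let e := hcd.toOpenPartialHomeomorph m hf' hω
  have hsrc : (0 : ℝ) ∈ e.source := hcd.mem_toOpenPartialHomeomorph_source hf' hω
  have hg0 : e.symm 0 = 0 := by
    have : e.symm (m 0) = 0 := e.left_inv hsrc
    rwa [hm0] at this
  have htgt : (0 : ℝ) ∈ e.target := by
    have : m 0 ∈ e.target := e.map_source hsrc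
    rwa [hm0] at this
  have hgan : ContDiffAt ℝ ω e.symm 0 := by
    have : ContDiffAt ℝ ω e.symm (m 0) := hcd.to_localInverse hf' hω
    rwa [hm0] at this
  have hev : ∀ᶠ s in 𝓝 (0 : ℝ), AnalyticAt ℝ e.symm s ∧ m (e.symm s) = s ∧ e.symm (m s) = s := by
    filter_upwards [hgan.eventually (by simp), e.open_target.mem_nhds htgt,
      e.open_source.mem_nhds hsrc] with s h1 h2 h3
    exact ⟨h1.analyticAt, e.right_inv h2, e.left_inv h3⟩
  obtain ⟨ε, hε, hball⟩ := Metric.eventually_nhds_iff_ball.1 hev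
  have hb : ∀ s, |s| < ε → s ∈ Metric.ball (0 : ℝ) ε := fun s hs => by
    rwa [mem_ball_zero_iff, Real.norm_eq_abs]
  exact ⟨e.symm, ε, hε, hg0, fun s hs => (hball s (hb s hs)).1, fun s hs => (hball s (hb s hs)).2.1,
    fun s hs => (hball s (hb s hs)).2.2⟩

/-! ### The center and the first integral given by the parabola -/

theorem exists_local_first_integral {F f : Polynomial ℝ}
    (hF : ∀ x : ℝ, F.eval (-x) = F.eval x) (hf : ∀ x : ℝ, F.eval x = f.eval (x ^ 2))
    {H : ℝ × ℝ → ℝ} (h1 : ∀ z : ℝ × ℝ, 0 ≤ z.1 → AnalyticAt ℝ H z)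
    (h2 : ∀ z : ℝ × ℝ, 0 ≤ z.1 → fderiv ℝ H z (2 * (f.eval z.1 - z.2), 1) = 0)
    (h3 : H (0, f.eval 0) = 0) (h4 : fderiv ℝ H (0, f.eval 0) (1, 0) = 1) :
    ∃ U : Set (ℝ × ℝ), IsOpen U ∧ (0, F.eval 0) ∈ U ∧ ∃ H : ℝ × ℝ → ℝ,
      (∀ z ∈ U, AnalyticAt ℝ H (z.1 ^ 2, z.2)) ∧
      IsAnalyticFirstIntegralOn F U (fun z => H (z.1 ^ 2, z.2)) ∧
      H (0, F.eval 0) = 0 ∧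
      ∀ z ∈ U, z ≠ (0, F.eval 0) → ∃ S, IsClosedOrbit F S ∧ z ∈ S ∧ S ⊆ U ∧
        ∃ a : ℝ, 0 < a ∧
          S ∩ {w | w.2 = F.eval 0 - w.1 ^ 2} = {(a, F.eval 0 - a ^ 2), (-a, F.eval 0 - a ^ 2)} ∧
          H (z.1 ^ 2, z.2) = a ^ 2 := by
  have hF0 : F.eval 0 = f.eval 0 := by simpa using hf 0
  have hint := isAnalyticFirstIntegralOn_univ hf h1 h2 h3 h4
  set J : ℝ × ℝ → ℝ := fun z => H (z.1 ^ 2, z.2) with hJ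
  have hJan : ∀ z, AnalyticAt ℝ J z := fun z => hint.1 z trivial
  have hJd : Differentiable ℝ J := fun z => (hJan z).differentiableAt
  rw [← hF0] at h3 h4
  -- The values of `J` on the parabola as a function of `a = x²`. Since `H_y = 0` and `H_u = 1` at
  -- the equilibrium, `m'(0) = 1`; its local inverse `g` recovers `x²` from `J`.
  let m : ℝ → ℝ := fun a => H (a, F.eval 0 - a)
  have hm0 : m 0 = 0 := by simpa [m] using h3
  have hman : AnalyticAt ℝ m 0 := by
    refine AnalyticAt.comp (g := H) (f := fun a : ℝ => (a, F.eval 0 - a)) (h1 _ le_rfl) ?_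
    exact analyticAt_id.prod (analyticAt_const.sub analyticAt_id)
  have hm1 : HasDerivAt m 1 0 := by
    have e1 : HasDerivAt (fun a : ℝ => (a, F.eval 0 - a)) (1, -1) 0 :=
      (hasDerivAt_id (0 : ℝ)).prodMk ((hasDerivAt_id (0 : ℝ)).const_sub _)
    have e2 := HasFDerivAt.comp_hasDerivAt (l := H) (f := fun a : ℝ => (a, F.eval 0 - a)) (0 : ℝ)
      (h1 _ le_rfl).differentiableAt.hasFDerivAt e1
    have e3 := h2 (0, F.eval 0) le_rfl
    simp only [hF0, sub_self, mul_zero] at e3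
    rw [← hF0] at e3
    have e4 : ((1, -1) : ℝ × ℝ) = (1, 0) - (0, 1) := by simp
    rw [sub_zero, e4, map_sub, h4, e3, sub_zero] at e2
    exact e2
  obtain ⟨g, ε₁, hε₁, hg0, hgan, hmg, hgm⟩ := exists_analytic_localInverse hman hm0 hm1
  obtain ⟨r₁, hr₁, hFr₁⟩ := exists_radius_abs_eval_sub_le hf
  obtain ⟨r₂, hr₂, hJr₂⟩ := exists_radius_leafIntegral_ge h1 h2 (hF0 ▸ h3) (hF0 ▸ h4)
  set r := min (min r₁ r₂) (min (1 / 16) (ε₁ / 2)) with hr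
  have hrpos : 0 < r := by positivity
  have hrr₁ : r ≤ r₁ := (min_le_left _ _).trans (min_le_left _ _)
  have hrr₂ : r ≤ r₂ := (min_le_left _ _).trans (min_le_right _ _)
  have hr16 : r ≤ 1 / 16 := (min_le_right _ _).trans (min_le_left _ _)
  have hrε : r ≤ ε₁ / 2 := (min_le_right _ _).trans (min_le_right _ _)
  set p : ℝ × ℝ := (0, F.eval 0) with hp
  have hdist : ∀ z : ℝ × ℝ, dist z p = max |z.1| |z.2 - F.eval 0| := fun z => by
    rw [Prod.dist_eq, Real.dist_eq, Real.dist_eq, sub_zero]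
  have hJge : ∀ z, dist z p ≤ r → (z.1 ^ 2 + (z.2 - F.eval 0) ^ 2) / 2 ≤ J z := fun z hz => by
    rw [hdist, max_le_iff] at hz
    rw [hF0] at hz ⊢
    exact hJr₂ z.1 z.2 (hz.1.trans hrr₂) (hz.2.trans hrr₂)
  -- Below `r²/2`, a lower bound of `J` on the sphere of radius `r`, orbits are trapped; below `ε₁`,
  -- `g` is defined and analytic.
  set ε := min ε₁ (r ^ 2 / 2) with hε
  have hεpos : 0 < ε := by positivity
  have hJp : J p = 0 := by simpa [J, hp] using h3
  have hsphere : ∀ z, dist z p = r → ε ≤ J z := fun z hz => by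
    refine (min_le_right _ _).trans (le_trans ?_ (hJge z hz.le))
    rw [hdist] at hz
    rcases max_choice |z.1| |z.2 - F.eval 0| with h | h <;> rw [h] at hz <;>
      rw [← hz, sq_abs] <;> nlinarith [sq_nonneg z.1, sq_nonneg (z.2 - F.eval 0)]
  let U : Set (ℝ × ℝ) := {z | dist z p < r ∧ J z < ε}
  have hUo : IsOpen U :=
    (isOpen_lt (continuous_id.dist continuous_const) continuous_const).inter
      (isOpen_lt hJd.continuous continuous_const)
  have hUJ : ∀ z ∈ U, |J z| < ε₁ := fun z hz => by
    have h0 : 0 ≤ J z := le_trans (by positivity) (hJge z hz.1.le)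
    rw [abs_of_nonneg h0]
    exact hz.2.trans_le (min_le_left _ _)
  have hgJ : ∀ z ∈ U, AnalyticAt ℝ (g ∘ H) (z.1 ^ 2, z.2) := fun z hz =>
    AnalyticAt.comp (g := g) (f := H) (hgan (J z) (hUJ z hz)) (h1 (z.1 ^ 2, z.2) (sq_nonneg z.1))
  refine ⟨U, hUo, ⟨by rwa [dist_self], by rwa [hJp]⟩, g ∘ H, hgJ, ⟨fun z hz =>
    analyticAt_comp_sq_prod (hgJ z hz), fun z hz => ?_, fun V hVU hV hVne => ?_⟩,
    by rw [Function.comp_apply, h3, hg0], fun z hz hzp => ?_⟩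
  · have e := ((hgan _ (hUJ z hz)).differentiableAt.hasFDerivAt.comp z (hJd z).hasFDerivAt).fderiv
    have e' : (fun z : ℝ × ℝ => (g ∘ H) (z.1 ^ 2, z.2)) = g ∘ J := rfl
    rw [e', e, ContinuousLinearMap.comp_apply, hint.2.1 z trivial, map_zero]
  · obtain ⟨a, ha, b, hb, hab⟩ := hint.2.2 V (Set.subset_univ _) hV hVne
    refine ⟨a, ha, b, hb, fun h => hab ?_⟩
    have := congrArg m (show g (J a) = g (J b) from h)
    rwa [hmg _ (hUJ a (hVU ha)), hmg _ (hUJ b (hVU hb))] at this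
  obtain ⟨c, hc0, hcall⟩ := exists_solution_mem_ball (contDiff_lienardField F 1) hJd
    (fun z => hint.2.1 z trivial) hrpos hsphere hz.1 hz.2
  have hc := fun t => (hcall t).1
  have hcU : ∀ t, c t ∈ U := fun t => ⟨(hcall t).2.1, by rw [(hcall t).2.2]; exact hz.2⟩
  have hcr : ∀ t, |(c t).1| ≤ r ∧ |(c t).2 - F.eval 0| ≤ r := fun t => by
    have := (hcall t).2.1.le
    rwa [hdist, max_le_iff] at this
  have hFr : ∀ x, |x| ≤ r → |F.eval x - F.eval 0| ≤ |x| / 16 := fun x hx => hFr₁ x (hx.trans hrr₁)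
  have hJzpos : 0 < J z := by
    refine lt_of_lt_of_le ?_ (hJge z hz.1.le)
    by_contra! hle
    have e1 : z.1 = 0 := by nlinarith [sq_nonneg z.1, sq_nonneg (z.2 - F.eval 0)]
    have e2 : z.2 - F.eval 0 = 0 := by nlinarith [sq_nonneg z.1, sq_nonneg (z.2 - F.eval 0)]
    exact hzp (Prod.ext e1 (sub_eq_zero.1 e2))
  -- The windows `[0, 7]` and `[8, 15]` are disjoint, so the two zeros of `x` give a positive
  -- period.
  obtain ⟨T₁, hT₁, hx₁⟩ := exists_solution_fst_eq_zero hc hFr hcr 0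
  obtain ⟨T₂, hT₂, hx₂⟩ := exists_solution_fst_eq_zero hc hFr hcr 8
  have hT : 0 < 2 * (T₂ - T₁) := by linarith [hT₁.2, hT₂.1]
  have hnc : ∃ t, c t ≠ c 0 := by
    by_contra! hconst
    have hd : HasDerivAt c 0 0 := by
      have : c = fun _ => c 0 := funext hconst
      rw [this]
      exact hasDerivAt_const _ _
    have hz0 := (hc 0).unique hd
    rw [hc0] at hz0
    have e1 : z.1 = 0 := by simpa [lienardField] using congrArg Prod.snd hz0
    have e2 : z.2 - F.eval z.1 = 0 := congrArg Prod.fst hz0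
    rw [e1] at e2
    exact hzp (Prod.ext e1 (sub_eq_zero.1 e2))
  obtain ⟨s, hs⟩ := exists_solution_mem_parabola hc hr16 hFr hcr
  have hpar : ∀ w ∈ Set.range c, w.2 = F.eval 0 - w.1 ^ 2 → w.1 ^ 2 = g (J z) := by
    rintro _ ⟨t, rfl⟩ ht
    have e : J (c t) = m ((c t).1 ^ 2) := by simp only [J, m, ht]
    rw [← (hcall t).2.2, e, hgm]
    have := (hcr t).1
    rw [abs_pow]
    nlinarith [abs_nonneg (c t).1]
  have hgs := hpar _ ⟨s, rfl⟩ hs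
  have hspos : 0 < |(c s).1| := by
    rw [abs_pos]
    intro h0
    rw [h0, zero_pow two_ne_zero] at hgs
    have := hmg _ (hUJ z hz)
    rw [← hgs, hm0] at this
    exact hJzpos.ne this
  have hmem : ∀ b, b ^ 2 = (c s).1 ^ 2 → (b, F.eval 0 - b ^ 2) ∈ Set.range c := fun b hb => by
    rcases sq_eq_sq_iff_eq_or_eq_neg.1 hb with h | h
    · exact ⟨s, Prod.ext h.symm (by rw [hs, hb])⟩
    · refine ⟨2 * T₁ - s, ?_⟩
      rw [solution_reflect hc hF hx₁]
      exact Prod.ext h.symm (by rw [hs, hb])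
  refine ⟨Set.range c, ⟨c, hc, ⟨_, hT, solution_periodic hc hF hx₁ hx₂⟩, hnc, rfl⟩, ⟨0, hc0⟩,
    Set.range_subset_iff.2 hcU, |(c s).1|, hspos, ?_, ?_⟩
  · ext w
    simp only [Set.mem_inter_iff, Set.mem_ofPred_eq, Set.mem_insert_iff, Set.mem_singleton_iff]
    constructor
    · rintro ⟨hw, hw2⟩
      have e : w.1 ^ 2 = |(c s).1| ^ 2 := by rw [hpar w hw hw2, sq_abs, hgs]
      rcases sq_eq_sq_iff_eq_or_eq_neg.1 e with h | h
      · exact Or.inl (Prod.ext h (by rw [hw2, e]))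
      · exact Or.inr (Prod.ext h (by rw [hw2, e]))
    · rintro (rfl | rfl)
      · exact ⟨hmem _ (sq_abs _), rfl⟩
      · refine ⟨?_, by simp⟩
        have := hmem (-|(c s).1|) (by rw [neg_sq, sq_abs])
        rwa [neg_sq] at this
  · rw [sq_abs, hgs]
    rfl

/-! ### Assembly -/

theorem mainTheorem2 (F : Polynomial ℝ) (hF : ∀ x : ℝ, F.eval (-x) = F.eval x) :
    -- center
    IsLienardCenter F (0, F.eval 0) ∧
    -- global analytic first integral, analytic in `(x ^ 2, y)`
    (∃ H : ℝ × ℝ → ℝ, (∀ z : ℝ × ℝ, AnalyticAt ℝ H (z.1 ^ 2, z.2)) ∧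
      IsAnalyticFirstIntegralOn F Set.univ (fun z => H (z.1 ^ 2, z.2))) ∧
    -- near the center, the squared abscissa of the intersection of the orbit with the parabola
    -- is such a first integral
    (∃ U : Set (ℝ × ℝ), IsOpen U ∧ (0, F.eval 0) ∈ U ∧ ∃ H : ℝ × ℝ → ℝ,
      (∀ z ∈ U, AnalyticAt ℝ H (z.1 ^ 2, z.2)) ∧
      IsAnalyticFirstIntegralOn F U (fun z => H (z.1 ^ 2, z.2)) ∧
      H (0, F.eval 0) = 0 ∧
      ∀ z ∈ U, z ≠ (0, F.eval 0) → ∃ S, IsClosedOrbit F S ∧ z ∈ S ∧ S ⊆ U ∧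
        ∃ a : ℝ, 0 < a ∧
          S ∩ {w | w.2 = F.eval 0 - w.1 ^ 2} = {(a, F.eval 0 - a ^ 2), (-a, F.eval 0 - a ^ 2)} ∧
          H (z.1 ^ 2, z.2) = a ^ 2) ∧
    -- kernel and cokernel on smooth and on real-analytic functions
    (∀ (n : WithTop ℕ∞) (hn : n = ∞ ∨ n = ω),
      ¬ FiniteDimensional ℝ (LinearMap.ker (lienardOperator F n hn)) ∧
      ¬ FiniteDimensional ℝ (lienardCokernel F n hn) ∧
      ∀ (m : ℕ) (γ : Fin m → Set (ℝ × ℝ)), Function.Injective γ →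
        (∀ i, IsClosedOrbit F (γ i)) →
        (∃ f : planeFunctions n,
          (∃ P : MvPolynomial (Fin 2) ℝ, ∀ z, f.1 z = MvPolynomial.eval ![z.1, z.2] P) ∧
          SeparatesSets f.1 γ) ∧
        ∀ f : planeFunctions n, SeparatesSets f.1 γ →
          LinearIndependent ℝ
            (fun k : Fin m => (Submodule.Quotient.mk (f ^ (k : ℕ)) : lienardCokernel F n hn))) := by
  obtain ⟨f, hf⟩ := exists_eval_sq_of_even hF
  obtain ⟨H, h1, h2, h3, h4⟩ := exists_leafIntegral f
  have hint := isAnalyticFirstIntegralOn_univ hf h1 h2 h3 h4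
  have hloc := exists_local_first_integral hF hf h1 h2 h3 h4
  have hsep : ∀ (n : WithTop ℕ∞) (m : ℕ) (γ : Fin m → Set (ℝ × ℝ)), Function.Injective γ →
      (∀ i, IsClosedOrbit F (γ i)) → ∃ f : planeFunctions n,
        (∃ P : MvPolynomial (Fin 2) ℝ, ∀ z, f.1 z = MvPolynomial.eval ![z.1, z.2] P) ∧
        SeparatesSets f.1 γ := fun n m γ hinj hγ => by
    obtain ⟨P, hP⟩ := exists_polynomial_separatesSets
      (fun i => isCompact_of_isClosedOrbit (hγ i)) fun i j hij => Set.disjoint_left.2 fun z hi hj =>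
        hij (hinj (closedOrbit_eq_of_mem (hγ i) (hγ j) hi hj))
    obtain ⟨q, hq⟩ := exists_polynomial_planeFunction n P
    exact ⟨q, ⟨P, hq⟩, by rwa [funext hq]⟩
  have horb : ∀ m : ℕ, ∃ γ : Fin m → Set (ℝ × ℝ), Function.Injective γ ∧
      ∀ i, IsClosedOrbit F (γ i) := fun m => by
    obtain ⟨U, hU, hpU, H', -, -, -, hcl⟩ := hloc
    have hev : ∀ᶠ a : ℝ in 𝓝 0, (a, F.eval 0 - a ^ 2) ∈ U := by
      have hc : Continuous fun a : ℝ => (a, F.eval 0 - a ^ 2) := by fun_prop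
      exact hc.continuousAt.preimage_mem_nhds (hU.mem_nhds (by simpa using hpU))
    obtain ⟨ε, hε, hball⟩ := Metric.eventually_nhds_iff_ball.1 hev
    -- Distinct positive abscissas on the parabola lie on distinct orbits, since each orbit meets it
    -- at only one. The shift by `2` keeps every `a i` strictly below `ε`.
    let a : Fin m → ℝ := fun i => ε / ((i : ℕ) + 2)
    have hapos : ∀ i, 0 < a i := fun i => by positivity
    have haU : ∀ i, (a i, F.eval 0 - a i ^ 2) ∈ U := fun i => hball _ (by
      rw [mem_ball_zero_iff, Real.norm_eq_abs, abs_of_pos (hapos i), div_lt_iff₀ (by positivity)]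
      have : (0 : ℝ) ≤ (i : ℕ) := Nat.cast_nonneg _
      nlinarith)
    choose S hS hzS _ b hb hSb _ using fun i => hcl _ (haU i)
      (fun h => (hapos i).ne' (congrArg Prod.fst h))
    have hab : ∀ i j, (a i, F.eval 0 - a i ^ 2) ∈ S j → a i = b j := fun i j h => by
      have hmem : (a i, F.eval 0 - a i ^ 2) ∈ S j ∩ {w | w.2 = F.eval 0 - w.1 ^ 2} := ⟨h, rfl⟩
      rw [hSb j] at hmem
      rcases hmem with h | h
      · exact congrArg Prod.fst h
      · have : a i = -b j := congrArg Prod.fst h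
        linarith [hapos i, hb j]
    refine ⟨S, fun i j hij => ?_, hS⟩
    have e : a i = a j := (hab i j (hij ▸ hzS i)).trans (hab j j (hzS j)).symm
    simp only [a] at e
    rw [div_eq_div_iff (by positivity) (by positivity), mul_right_inj' hε.ne'] at e
    have : ((i : ℕ) : ℝ) = (j : ℕ) := by linarith
    exact Fin.ext (by exact_mod_cast this)
  refine ⟨⟨by simp [lienardField], ?_⟩, ⟨H, fun z => h1 _ (sq_nonneg z.1), hint⟩, hloc,
    fun n hn => ⟨not_finiteDimensional_ker hint n hn, ?_, fun m γ hinj hγ =>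
      ⟨hsep n m γ hinj hγ, fun f hfγ => linearIndependent_pow_cokernel hn hγ hfγ⟩⟩⟩
  · obtain ⟨U, hU, hpU, H', -, -, -, hcl⟩ := hloc
    exact ⟨U, hU.mem_nhds hpU, fun z hz hzp => by
      obtain ⟨S, hS, hzS, hSU, -⟩ := hcl z hz hzp
      exact ⟨S, hS, hzS, hSU⟩⟩
  · refine not_finiteDimensional_of_forall_linearIndependent fun m => ?_
    obtain ⟨γ, hinj, hγ⟩ := horb m
    obtain ⟨q, -, hq⟩ := hsep n m γ hinj hγ
    exact ⟨_, linearIndependent_pow_cokernel hn hγ hq⟩
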